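/- \textbf{Model.} A tournament tree on $n$ keys is a rooted binary tree in which every internal node has two children and whose $n$ leaves store the $n$ keys, one each. It is manipulated through fingers $F_1,\dots,F_k$ (pointers to nodes) and a temporary finger $F_0$, which is unset at the start of every access. One operation is one of the following, for some $i\in\{1,\dots,k\}$: move $F_i$ to the parent, left child or right child of its location (if the pointer is not null); copy the location of $F_i$ into $F_0$; move $F_i$ to the location $F_0$; swap the subtree rooted at $F_0$ with the subtree rooted at the left or right child of $F_i$ (if this child exists and the two subtrees are disjoint); detach the subtree rooted at $F_0$ from its parent and make it the left or right child of $F_i$ (if that pointer is null, $F_i$ is not at a leaf storing a key, and $F_i$ is not in that subtree); serve the request from $F_i$ (if the requested key is stored at its location). An access to a key is served by a finite sequence of operations whose last operation, and only this one, is the serve operation; its cost is the number of operations. The fingers are \emph{transient} if they are all reset to the root at the start of every access, and \emph{persistent} if they keep their locations between accesses (initially arbitrary). A (deterministic) online algorithm chooses the operations for each access from the accesses made so far, including the current one, and must be able to serve every access sequence. The offline optimum $\mathrm{OPT}_j(A)$ is the minimum total cost of serving the access sequence $A$ with $j$ transient fingers, starting from the same initial tree. The competitive ratio of an online algorithm $\mathrm{ALG}$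 against $j$ transient offline fingers is $$\liminf_{m\to\infty}\ \max_{A\text{ of length }m}\ \frac{\mathrm{cost}(\mathrm{ALG}(A))}{\mathrm{OPT}_j(A)}.$$ \textbf{Corollary (Few Fingers).} There are absolute constants $c,C>0$ and $n_0$ such that for all $n\ge n_0$, all $k\ge 1$, every initial tournament tree on $n$ keys and every online algorithm $\mathrm{ALG}$ with $k$ fingers, transient or persistent (with arbitrary initial locations), the following holds. 1. There is an access sequence $A$ of length $n$, accessing every key exactly once, with $$\mathrm{cost}(\mathrm{ALG}(A))\ \ge\ c\, n\,\frac{\log n}{\log \max(k,2)}\qquad\text{and}\qquad \mathrm{OPT}_1(A)\le C n .$$ 2. For every $j\ge 1$, the competitive ratio of $\mathrm{ALG}$ against $j$ transient offline fingers is at least $c\,\dfrac{\log n}{\log \max(k,2)}$. In particular (with $j=k$) the competitive ratio of tournament heaps with $k$ fingers is $\Omega(\log n/\log k)$, and (with $j=1$) this holds even if the online algorithm has $k$ persistent fingers and the offline algorithm has a single transient finger. -/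

import Mathlib

open scoped ENNReal

namespace TournamentHeap

/-- A pointer-based binary tree on the node set `V`: every node has a parent pointer, a left
(`false`) and a right (`true`) child pointer, each possibly null, and possibly stores one of the
keys `0, …, n - 1`. -/
structure PTree (n : ℕ) (V : Type) where
  root : V
  parent : V → Option V
  child : V → Bool → Option V
  key : V → Option (Fin n)

namespace PTree

variable {n : ℕ} {V : Type}

/-- `T.InSubtree u v`: the node `u` lies in the subtree rooted at `v` (possibly `u = v`), i.e.
following parent pointers leads from `u` to `v`. -/
def InSubtree (T : PTree n V) (u v : V) : Prop :=
  Relation.ReflTransGen (fun a b => T.parent a = some b) u v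

/-- `T` is a tournament tree: a rooted binary tree in which every internal node has two children
and which stores each of the `n` keys in exactly one leaf, every leaf storing a key. -/
structure IsTournament (T : PTree n V) : Prop where
  parent_iff : ∀ v p, T.parent v = some p ↔ ∃ d, T.child p d = some v
  children_ne : ∀ p v, T.child p false = some v → T.child p true ≠ some v
  root_parent : T.parent T.root = none
  connected : ∀ v, T.InSubtree v T.root
  node_cases : ∀ v,
    (T.key v = none ∧ ∀ d, T.child v d ≠ none) ∨ (T.key v ≠ none ∧ ∀ d, T.child v d = none)
  key_unique : ∀ x, ∃! v, T.key v = some x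

variable [DecidableEq V]

/-- Exchange the (disjoint) subtrees rooted at `v` and `w`. -/
def swapSubtrees (T : PTree n V) (v w : V) : PTree n V where
  root := T.root
  parent := fun u => T.parent (Equiv.swap v w u)
  child := fun u e => (T.child u e).map (Equiv.swap v w)
  key := T.key

/-- Detach the subtree rooted at `v` from its parent and make it the `d`-child of `p`. -/
def relink (T : PTree n V) (v p : V) (d : Bool) : PTree n V where
  root := T.root
  parent := Function.update T.parent v (some p)
  child := fun u e =>
    if u = p ∧ e = d then some v else if T.child u e = some v then none else T.child u e
  key := T.key

end PTree

/-- The operations that finger `F i` can perform, other than serving the request. -/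
inductive Op (k : ℕ)
  /-- Move `F i` to the parent of its location. -/
  | up (i : Fin k)
  /-- Move `F i` to the left or right child of its location. -/
  | down (i : Fin k) (d : Bool)
  /-- Copy the location of `F i` into the temporary finger. -/
  | save (i : Fin k)
  /-- Move `F i` to the location of the temporary finger. -/
  | load (i : Fin k)
  /-- Swap the subtree at the temporary finger with the left or right child of `F i`. -/
  | swap (i : Fin k) (d : Bool)
  /-- Detach the subtree at the temporary finger and make it the left or right child of `F i`. -/
  | link (i : Fin k) (d : Bool)

/-- A configuration: the tree, the locations of the `k` fingers, and the location of the temporary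
finger (`none` if it has not been set during the current access). -/
structure State (n k : ℕ) (V : Type) where
  tree : PTree n V
  finger : Fin k → V
  temp : Option V

section Execution

variable {n k : ℕ} {V : Type} [DecidableEq V]

open Classical in
/-- The effect of an operation; `none` if the operation is not permitted. A swap needs a non-null
child and disjoint subtrees; a link needs a null pointer at a node that is not a leaf storing a
key, a moved subtree that has a parent, and no cycle to arise. -/
noncomputable def Op.apply (s : State n k V) : Op k → Option (State n k V)
  | .up i => (s.tree.parent (s.finger i)).map
      fun p => { s with finger := Function.update s.finger i p }
  | .down i d => (s.tree.child (s.finger i) d).map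
      fun w => { s with finger := Function.update s.finger i w }
  | .save i => some { s with temp := some (s.finger i) }
  | .load i => s.temp.map fun v => { s with finger := Function.update s.finger i v }
  | .swap i d => s.temp.bind fun v => (s.tree.child (s.finger i) d).bind fun w =>
      if ¬ s.tree.InSubtree v w ∧ ¬ s.tree.InSubtree w v then
        some { s with tree := s.tree.swapSubtrees v w }
      else none
  | .link i d => s.temp.bind fun v =>
      if s.tree.child (s.finger i) d = none ∧ s.tree.key (s.finger i) = none ∧
          s.tree.parent v ≠ none ∧ ¬ s.tree.InSubtree (s.finger i) v then
        some { s with tree := s.tree.relink v (s.finger i) d }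
      else none

/-- How one access is served: a list of operations, and then the serve operation, performed by
the finger `server`. -/
structure Plan (k : ℕ) where
  ops : List (Op k)
  server : Fin k

/-- The number of operations, including the final serve operation. -/
def Plan.cost (p : Plan k) : ℕ := p.ops.length + 1

/-- Transient fingers are all reset to the root before each access; persistent fingers keep their
locations. -/
inductive FingerMode
  | transient
  | persistent

/-- The configuration in which an access starts. -/
def State.beginAccess (s : State n k V) : FingerMode → State n k V
  | .transient => { s with finger := fun _ => s.tree.root, temp := none }
  | .persistent => { s with temp := none }

/-- Serve one access to the key `x`; `none` if some operation is not permitted or `x` is not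
stored at the location of the serving finger. -/
noncomputable def State.serve (mode : FingerMode) (s : State n k V) (x : Fin n) (p : Plan k) :
    Option (State n k V) :=
  (p.ops.foldlM Op.apply (s.beginAccess mode)).bind fun s' =>
    if s'.tree.key (s'.finger p.server) = some x then some s' else none

/-- The plans `P` serve the accesses `A`, one after another, from the configuration `s`. -/
def Serves (mode : FingerMode) : State n k V → List (Fin n) → List (Plan k) → Prop
  | _, [], [] => True
  | s, x :: A, p :: P => ∃ s', s.serve mode x p = some s' ∧ Serves mode s' A P
  | _, _, _ => False

/-- The total number of operations. -/
def totalCost (P : List (Plan k)) : ℕ := (P.map Plan.cost).sum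

/-- The offline optimum: the minimum total cost of serving `A` from the configuration `s` when
all of `A` is known. -/
noncomputable def offlineOpt (mode : FingerMode) (s : State n k V) (A : List (Fin n)) : ℝ≥0∞ :=
  ⨅ (P : List (Plan k)) (_ : Serves mode s A P), (totalCost P : ℝ≥0∞)

/-- The configuration with the tree `T` and all `k` fingers at the root. -/
def PTree.atRoot (T : PTree n V) (k : ℕ) : State n k V where
  tree := T
  finger := fun _ => T.root
  temp := none

end Execution

/-- A (deterministic) online algorithm: it decides how to serve an access from the list of the
previous accesses and the current one. -/
def OnlineAlgorithm (n k : ℕ) : Type := List (Fin n) → Fin n → Plan k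

namespace OnlineAlgorithm

variable {n k : ℕ} {V : Type} [DecidableEq V]

/-- The plans used for the accesses `A` after the accesses `past`. -/
def plansFrom (alg : OnlineAlgorithm n k) : List (Fin n) → List (Fin n) → List (Plan k)
  | _, [] => []
  | past, x :: A => alg past x :: alg.plansFrom (past ++ [x]) A

/-- The plans used for the access sequence `A`. -/
def plans (alg : OnlineAlgorithm n k) (A : List (Fin n)) : List (Plan k) := alg.plansFrom [] A

/-- The total cost of the algorithm on `A`. -/
def cost (alg : OnlineAlgorithm n k) (A : List (Fin n)) : ℕ := totalCost (alg.plans A)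

/-- Started in the configuration `s`, the algorithm serves every access sequence. -/
def Correct (alg : OnlineAlgorithm n k) (mode : FingerMode) (s : State n k V) : Prop :=
  ∀ A : List (Fin n), Serves mode s A (alg.plans A)

/-- The competitive ratio of the algorithm against an offline algorithm with `j` fingers that
starts with the tree `T`: the limit, as `m → ∞`, of the maximal quotient of the online cost and the
offline optimum over the access sequences of length `m`. The lower limit is taken, so that a lower
bound holds for all large `m`. -/
noncomputable def competitiveRatio (alg : OnlineAlgorithm n k) (offMode : FingerMode) (j : ℕ)
    (T : PTree n V) : ℝ≥0∞ :=
  Filter.liminf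
    (fun m : ℕ => ⨆ (A : List (Fin n)) (_ : A.length = m),
      (alg.cost A : ℝ≥0∞) / offlineOpt offMode (T.atRoot j) A)
    Filter.atTop

end OnlineAlgorithm

end TournamentHeap

/-! The lower bound is an information-theoretic count of cheap executions that does not depend on
the tree. An algorithm learns about the tree only through the pointers it follows, so an execution
can be recorded with the nodes named in order of discovery (`Lazy`). Every operation has O(k)
choices. A followed pointer is null, leads to a new node, or leads to a node already named. The last
case seems to allow many outcomes, but it joins two explored pieces of the tree: some named node
whose parent was unknown now has a known parent. At most k + 1 such nodes exist at the start (the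
finger locations and the root), and discoveries never increase their number. With M bounding the
number of names, this costs only a factor of about M^(k+1) in total, and executions of cost D number
at most (O(k))^D times that factor (`weight_reach`).

Now consider two runs from one configuration, one serving keys x and one serving the same keys in
the order x ∘ τ. The names of the serving nodes in the two runs reveal τ. Hence, if pairs of runs of
cost at most D are fewer than m!, a single τ is bad for all configurations and all choices of m
keys: one of the two orders costs more than D (`exists_perm_forall_lt_cost`).

The adversary cuts the leaf sequence of the current offline tree into rows of about n^(1/4) keys and
requests each row either as it is or permuted by τ, whichever is costly online
(`Separating.exists_costly`). Since τ is the same for all rows, the offline algorithm can permute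
all chosen rows together: it separates them from the others, transposes them into columns, permutes
the columns once, and undoes the rest (`Trans.permuteRows`). This takes linear cost by local subtree
swaps with one finger, and the resulting path of leaves is then served by rotations at constant cost
per key. Choosing D of order m log m / log k makes the online cost of the block of order n log n /
log k. If k is so large that the count fails, log n / log k is bounded and the trivial cost n
suffices. The offline tree after a block again stores all keys, so blocks can be repeated for the
competitive ratio. -/

namespace TournamentHeap

/-! ### Invariants preserved by the operations -/

namespace PTree

variable {n : ℕ} {V : Type}

/-- Parent and child pointers are inverse to each other, and the two children of a node are
distinct. -/
structure Consistent (T : PTree n V) : Prop where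
  parent_iff : ∀ v p, T.parent v = some p ↔ ∃ d, T.child p d = some v
  child_inj : ∀ p d e v, T.child p d = some v → T.child p e = some v → d = e

theorem IsTournament.consistent {T : PTree n V} (h : T.IsTournament) : T.Consistent where
  parent_iff := h.parent_iff
  child_inj p d e v hd he := by
    cases d <;> cases e
    · rfl
    · exact absurd he (h.children_ne p v hd)
    · exact absurd hd (h.children_ne p v he)
    · rfl

variable [DecidableEq V]

theorem Consistent.swapSubtrees {T : PTree n V} (h : T.Consistent) (v w : V) :
    (T.swapSubtrees v w).Consistent where
  parent_iff u p := by
    simp only [PTree.swapSubtrees, h.parent_iff, Option.map_eq_some_iff]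
    constructor
    · rintro ⟨d, hd⟩
      exact ⟨d, _, hd, Equiv.swap_apply_self v w u⟩
    · rintro ⟨d, a, hd, rfl⟩
      exact ⟨d, by rwa [Equiv.swap_apply_self]⟩
  child_inj p d e u hd he := by
    simp only [PTree.swapSubtrees, Option.map_eq_some_iff] at hd he
    obtain ⟨a, ha, rfl⟩ := hd
    obtain ⟨b, hb, hab⟩ := he
    rw [(Equiv.swap v w).injective hab] at hb
    exact h.child_inj _ _ _ _ ha hb

theorem Consistent.relink {T : PTree n V} (h : T.Consistent) (v p : V) (d : Bool)
    (hp : T.child p d = none) : (T.relink v p d).Consistent where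
  parent_iff u q := by
    simp only [PTree.relink]
    by_cases huv : u = v
    · subst huv
      simp only [Function.update_self, Option.some.injEq]
      constructor
      · rintro rfl
        exact ⟨d, by simp⟩
      · rintro ⟨e, he⟩
        split_ifs at he with h1 h2
        · exact h1.1.symm
        · exact absurd he h2
    · rw [Function.update_of_ne huv, h.parent_iff]
      constructor
      · rintro ⟨e, he⟩
        refine ⟨e, ?_⟩
        have h1 : ¬ (q = p ∧ e = d) := by
          rintro ⟨rfl, rfl⟩
          simp [hp] at he
        have h2 : T.child q e ≠ some v := by
          rw [he]
          simpa using huv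
        rw [if_neg h1, if_neg h2, he]
      · rintro ⟨e, he⟩
        refine ⟨e, ?_⟩
        split_ifs at he with h1 h2
        · exact absurd (Option.some.inj he).symm huv
        · exact he
  child_inj q e f u he hf := by
    simp only [PTree.relink] at he hf
    split_ifs at he hf with h1 h2 h3 h4 h5 h6
    · exact h1.2.trans h2.2.symm
    · exact absurd (hf.trans he.symm) h3
    · exact absurd (he.trans hf.symm) h4
    · exact h.child_inj _ _ _ _ he hf

end PTree

theorem State.beginAccess_tree {n k : ℕ} {V : Type} (s : State n k V) (mode : FingerMode) :
    (s.beginAccess mode).tree = s.tree := by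
  cases mode <;> rfl

section Preservation

variable {n k : ℕ} {V : Type} [DecidableEq V]

/-- What no operation changes. -/
theorem Op.apply_invariant {s s' : State n k V} {o : Op k} (h : o.apply s = some s')
    (hs : s.tree.Consistent) :
    s'.tree.Consistent ∧ s'.tree.key = s.tree.key ∧ s'.tree.root = s.tree.root := by
  cases o with
  | up i =>
    simp only [Op.apply, Option.map_eq_some_iff] at h
    obtain ⟨p, -, rfl⟩ := h
    exact ⟨hs, rfl, rfl⟩
  | down i d =>
    simp only [Op.apply, Option.map_eq_some_iff] at h
    obtain ⟨p, -, rfl⟩ := h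
    exact ⟨hs, rfl, rfl⟩
  | save i =>
    simp only [Op.apply, Option.some.injEq] at h
    subst h
    exact ⟨hs, rfl, rfl⟩
  | load i =>
    simp only [Op.apply, Option.map_eq_some_iff] at h
    obtain ⟨p, -, rfl⟩ := h
    exact ⟨hs, rfl, rfl⟩
  | swap i d =>
    simp only [Op.apply, Option.bind_eq_some_iff] at h
    obtain ⟨v, -, w, -, h⟩ := h
    split_ifs at h
    cases h
    exact ⟨hs.swapSubtrees v w, rfl, rfl⟩
  | link i d =>
    simp only [Op.apply, Option.bind_eq_some_iff] at h
    obtain ⟨v, -, h⟩ := h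
    split_ifs at h with h1
    cases h
    exact ⟨hs.relink v _ d h1.1, rfl, rfl⟩

theorem ops_invariant {ops : List (Op k)} {s s' : State n k V}
    (h : ops.foldlM Op.apply s = some s') (hs : s.tree.Consistent) :
    s'.tree.Consistent ∧ s'.tree.key = s.tree.key ∧ s'.tree.root = s.tree.root := by
  induction ops generalizing s with
  | nil =>
    cases h
    exact ⟨hs, rfl, rfl⟩
  | cons o ops ih =>
    rw [List.foldlM_cons] at h
    obtain ⟨s₁, h₁, h₂⟩ := Option.bind_eq_some_iff.1 h
    obtain ⟨c, hk, hr⟩ := Op.apply_invariant h₁ hs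
    obtain ⟨c', hk', hr'⟩ := ih h₂ c
    exact ⟨c', hk'.trans hk, hr'.trans hr⟩

theorem State.serve_eq_some {mode : FingerMode} {s s' : State n k V} {x : Fin n} {p : Plan k}
    (h : s.serve mode x p = some s') :
    p.ops.foldlM Op.apply (s.beginAccess mode) = some s' ∧
      s'.tree.key (s'.finger p.server) = some x := by
  simp only [State.serve, Option.bind_eq_some_iff] at h
  obtain ⟨s₁, h₁, h₂⟩ := h
  split_ifs at h₂ with h₃
  cases h₂
  exact ⟨h₁, h₃⟩

theorem State.serve_invariant {mode : FingerMode} {s s' : State n k V} {x : Fin n} {p : Plan k}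
    (h : s.serve mode x p = some s') (hs : s.tree.Consistent) :
    s'.tree.Consistent ∧ s'.tree.key = s.tree.key ∧ s'.tree.root = s.tree.root := by
  have := ops_invariant (State.serve_eq_some h).1 (by rwa [State.beginAccess_tree])
  rwa [State.beginAccess_tree] at this

end Preservation

/-! ### Partially explored configurations -/

/-- The parent pointer (`none`) and the two child pointers of a node. -/
def PTree.ptr {n : ℕ} {V : Type} (T : PTree n V) (v : V) : Option Bool → Option V
  | none => T.parent v
  | some d => T.child v d

/-- Partial knowledge of the pointers of a tree whose nodes are named by numbers: the outer `none`
stands for an unknown pointer. -/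
abbrev Know : Type := ℕ → Option Bool → Option (Option ℕ)

/-- Record that `v` is the `d`-child of `p`. -/
def Know.link (K : Know) (v p : ℕ) (d : Bool) : Know := fun a σ =>
  if a = v ∧ σ = none then some (some p)
  else if a = p ∧ σ = some d then some (some v) else K a σ

/-- Record that a pointer is null. -/
def Know.null (K : Know) (a₀ : ℕ) (σ₀ : Option Bool) : Know := fun a σ =>
  if a = a₀ ∧ σ = σ₀ then some none else K a σ

/-- The counterpart of `PTree.swapSubtrees`. -/
def Know.swap (K : Know) (v w : ℕ) : Know := fun a σ =>
  match σ with
  | none => K (Equiv.swap v w a) none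
  | some d => (K a (some d)).map (Option.map (Equiv.swap v w))

/-- The counterpart of `PTree.relink`. -/
def Know.relink (K : Know) (v p : ℕ) (d : Bool) : Know := fun a σ =>
  match σ with
  | none => if a = v then some (some p) else K a none
  | some e =>
    if a = p ∧ e = d then some (some v)
    else if K a (some e) = some (some v) then some none else K a (some e)

/-- A configuration of which only a part has been explored. The explored nodes are named by the
numbers below `N`; `init` and `cur` describe the initial and the current tree, and `out` lists the
nodes at which requests have been served. -/
structure Lazy (k : ℕ) where
  N : ℕ
  root : ℕ
  init : Know
  cur : Know
  finger : Fin k → ℕ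
  temp : Option ℕ
  out : List ℕ

namespace Lazy

variable {k : ℕ}

def link (L : Lazy k) (v p : ℕ) (d : Bool) : Lazy k :=
  { L with init := L.init.link v p d, cur := L.cur.link v p d }

def null (L : Lazy k) (a : ℕ) (σ : Option Bool) : Lazy k :=
  { L with init := L.init.null a σ, cur := L.cur.null a σ }

def extend (L : Lazy k) : Lazy k := { L with N := L.N + 1 }

/-- The possible outcomes of exploring a pointer. -/
def reveal (M : ℕ) (L : Lazy k) (a : ℕ) : Option Bool → List (Lazy k)
  | none =>
    if L.init a none ≠ none then [L]
    else if a < L.N then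
      -- The parent is null, a new node with `a` on either side, or a named node with `a` on either
      -- side.
      [L.null a none, L.extend.link a L.N false, L.extend.link a L.N true] ++
        (List.range M).flatMap fun p => [L.link a p false, L.link a p true]
    else []
  | some d =>
    if L.init a (some d) ≠ none then [L]
    else [L.null a (some d), L.extend.link L.N a d] ++
      -- A child that is already named must have an unexplored parent pointer, since edges are
      -- always recorded at both ends.
      ((List.range M).filter fun v => v < L.N ∧ L.init v none = none).map fun v => L.link v a d

def setFinger (L : Lazy k) (i : Fin k) (a : ℕ) : Lazy k :=
  { L with finger := Function.update L.finger i a }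

/-- Move a finger along an explored pointer. -/
def move (L : Lazy k) (i : Fin k) (σ : Option Bool) : List (Lazy k) :=
  match L.cur (L.finger i) σ with
  | some (some b) => [L.setFinger i b]
  | _ => []

def swap (L : Lazy k) (v w : ℕ) : Lazy k := { L with cur := L.cur.swap v w }

def relink (L : Lazy k) (v p : ℕ) (d : Bool) : Lazy k := { L with cur := L.cur.relink v p d }

/-- Swap `a` with the node that an explored pointer of the finger `i` leads to. -/
def swapWith (M : ℕ) (L : Lazy k) (i : Fin k) (d : Bool) (a : ℕ) : List (Lazy k) :=
  match L.cur (L.finger i) (some d) with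
  | some (some b) =>
    -- Both parent pointers are explored first, so that the swap changes explored pointers only; all
    -- others still agree with the initial tree.
    (L.reveal M a none).flatMap fun L₂ => (L₂.reveal M b none).map fun L₃ => L₃.swap a b
  | _ => []

/-- The possible outcomes of an operation. -/
def step (M : ℕ) (L : Lazy k) : Op k → List (Lazy k)
  | .up i => (L.reveal M (L.finger i) none).flatMap fun L₁ => L₁.move i none
  | .down i d => (L.reveal M (L.finger i) (some d)).flatMap fun L₁ => L₁.move i (some d)
  | .save i => [{ L with temp := some (L.finger i) }]
  | .load i =>
    match L.temp with
    | some a => [L.setFinger i a]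
    | none => []
  | .swap i d =>
    match L.temp with
    | some a => (L.reveal M (L.finger i) (some d)).flatMap fun L₁ => L₁.swapWith M i d a
    | none => []
  | .link i d =>
    match L.temp with
    | some a => (L.reveal M (L.finger i) (some d)).flatMap fun L₁ =>
        (L₁.reveal M a none).map fun L₂ => L₂.relink a (L₂.finger i) d
    | none => []

/-- The start of an access. -/
def beginAccess (L : Lazy k) : FingerMode → Lazy k
  | .transient => { L with finger := fun _ => L.root, temp := none }
  | .persistent => { L with temp := none }

/-- Serve a request from the finger `j` and start the next access. -/
def serve (mode : FingerMode) (L : Lazy k) (j : Fin k) : Lazy k :=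
  beginAccess { L with out := L.out ++ [L.finger j] } mode

/-- Return to the initial tree, with the fingers at `g`. -/
def restart (L : Lazy k) (g : Fin k → ℕ) : Lazy k :=
  { L with cur := L.init, finger := g, temp := none }

def allOps (k : ℕ) : List (Op k) :=
  (List.finRange k).flatMap fun i =>
    [.up i, .down i false, .down i true, .save i, .load i, .swap i false, .swap i true,
      .link i false, .link i true]

/-- The possible configurations after at most one operation. -/
def next (mode : FingerMode) (M : ℕ) (L : Lazy k) : List (Lazy k) :=
  L :: ((allOps k).flatMap (L.step M) ++ (List.finRange k).map (L.serve mode))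

/-- The possible configurations after at most `ℓ` operations. -/
def reach (mode : FingerMode) (M : ℕ) : ℕ → Lazy k → List (Lazy k)
  | 0, L => [L]
  | ℓ + 1, L => (L.next mode M).flatMap (reach mode M ℓ)

/-! ### Counting -/

/-- The number of explored nodes with unexplored parent pointer. -/
def orphans (L : Lazy k) : ℕ := ((Finset.range L.N).filter fun v => L.init v none = none).card

/-- A potential bounding the number of outcomes: a future reunion of two explored pieces has up to Q
outcomes and uses up an orphan, so each orphan is charged a factor Q in advance. -/
def weight (Q : ℕ) (S : List (Lazy k)) : ℕ := (S.map fun L => Q ^ L.orphans).sum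

@[simp] theorem weight_nil (Q : ℕ) : weight Q ([] : List (Lazy k)) = 0 := rfl

@[simp] theorem weight_cons (Q : ℕ) (L : Lazy k) (S : List (Lazy k)) :
    weight Q (L :: S) = Q ^ L.orphans + weight Q S := by
  simp [weight]

@[simp] theorem weight_append (Q : ℕ) (S S' : List (Lazy k)) :
    weight Q (S ++ S') = weight Q S + weight Q S' := by
  simp [weight]

theorem length_le_weight {Q : ℕ} (hQ : 0 < Q) (S : List (Lazy k)) : S.length ≤ weight Q S := by
  induction S with
  | nil => simp
  | cons L S ih =>
    have := Nat.one_le_pow L.orphans Q hQ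
    simp only [List.length_cons, weight_cons]
    omega

theorem weight_flatMap_le {α : Type} {Q c : ℕ} (S : List α) (f : α → List (Lazy k))
    (h : ∀ a ∈ S, weight Q (f a) ≤ c) : weight Q (S.flatMap f) ≤ S.length * c := by
  induction S with
  | nil => simp
  | cons a S ih =>
    have h1 := h a (by simp)
    have h2 := ih fun b hb => h b (by simp [hb])
    simp only [List.flatMap_cons, weight_append, List.length_cons]
    nlinarith

theorem weight_map_le {α : Type} {Q c : ℕ} (S : List α) (f : α → Lazy k)
    (h : ∀ a ∈ S, Q ^ (f a).orphans ≤ c) : weight Q (S.map f) ≤ S.length * c := by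
  rw [List.map_eq_flatMap]
  exact weight_flatMap_le S (fun a => [f a]) (by simpa using h)

theorem weight_flatMap {Q c : ℕ} (S : List (Lazy k)) (f : Lazy k → List (Lazy k))
    (h : ∀ L, weight Q (f L) ≤ c * Q ^ L.orphans) : weight Q (S.flatMap f) ≤ c * weight Q S := by
  induction S with
  | nil => simp
  | cons a S ih =>
    have h1 := h a
    simp only [List.flatMap_cons, weight_append, weight_cons]
    nlinarith

theorem weight_map {Q : ℕ} (S : List (Lazy k)) (f : Lazy k → Lazy k)
    (h : ∀ L, (f L).orphans = L.orphans) : weight Q (S.map f) = weight Q S := by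
  simp [weight, Function.comp_def, h]

theorem orphans_null_le (L : Lazy k) (a : ℕ) (σ : Option Bool) :
    (L.null a σ).orphans ≤ L.orphans := by
  refine Finset.card_le_card fun v hv => ?_
  rw [Finset.mem_filter] at hv ⊢
  refine ⟨hv.1, ?_⟩
  have := hv.2
  simp only [null, Know.null] at this
  split_ifs at this
  exact this

theorem orphans_link_lt (L : Lazy k) {v : ℕ} (hv : v < L.N) (h : L.init v none = none) (p : ℕ)
    (d : Bool) : (L.link v p d).orphans < L.orphans := by
  refine Finset.card_lt_card (Finset.ssubset_iff_of_subset (fun u hu => ?_) |>.2 ⟨v, ?_, ?_⟩)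
  · simp only [link, Know.link, Finset.mem_filter] at hu ⊢
    refine ⟨hu.1, ?_⟩
    have := hu.2
    split_ifs at this
    exact this
  · simp [hv, h]
  · simp [link, Know.link]

theorem orphans_extend_le (L : Lazy k) : L.extend.orphans ≤ L.orphans + 1 := by
  simp only [orphans, extend, Finset.range_add_one, Finset.filter_insert]
  split_ifs
  · exact Finset.card_insert_le _ _
  · omega

/-- The new parent is itself an orphan, but it replaces `v`. -/
theorem orphans_extend_link_old (L : Lazy k) {v : ℕ} (hv : v < L.N) (h : L.init v none = none)
    (p : ℕ) (d : Bool) : (L.extend.link v p d).orphans ≤ L.orphans := by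
  have h1 := orphans_link_lt L.extend (v := v) (by simp only [extend]; omega) h p d
  have h2 := orphans_extend_le L
  omega

theorem orphans_extend_link_new (L : Lazy k) (p : ℕ) (d : Bool) :
    (L.extend.link L.N p d).orphans ≤ L.orphans := by
  refine Finset.card_le_card fun u hu => ?_
  simp only [link, Know.link, extend, Finset.mem_filter, Finset.mem_range] at hu ⊢
  obtain ⟨h1, h2⟩ := hu
  split_ifs at h2 with h3 h4
  simp only [and_true] at h3
  exact ⟨by omega, h2⟩

/-- Null or a new neighbour gives boundedly many outcomes without more orphans. A known neighbour
gives at most 2M outcomes, each with one orphan fewer, so with base 2M these contribute at most the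
old weight once more. -/
theorem weight_reveal {M : ℕ} (hM : 0 < M) (L : Lazy k) (a : ℕ) (σ : Option Bool) :
    weight (2 * M) (L.reveal M a σ) ≤ 4 * (2 * M) ^ L.orphans := by
  have hQ : 0 < 2 * M := by omega
  have hmono : ∀ {x y : ℕ}, x ≤ y → (2 * M) ^ x ≤ (2 * M) ^ y := Nat.pow_le_pow_right hQ
  cases σ with
  | none =>
    simp only [reveal]
    split_ifs with h1 h2
    · simp; omega
    · rw [not_not] at h1
      have e1 := hmono (orphans_null_le L a none)
      have e2 := hmono (orphans_extend_link_old L h2 h1 L.N false)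
      have e3 := hmono (orphans_extend_link_old L h2 h1 L.N true)
      have e4 : weight (2 * M) ((List.range M).flatMap fun p =>
          [L.link a p false, L.link a p true]) ≤ M * (2 * (2 * M) ^ (L.orphans - 1)) := by
        refine (weight_flatMap_le _ _ fun p _ => ?_).trans_eq (by rw [List.length_range])
        have f1 := hmono (Nat.le_sub_one_of_lt (orphans_link_lt L h2 h1 p false))
        have f2 := hmono (Nat.le_sub_one_of_lt (orphans_link_lt L h2 h1 p true))
        simp only [weight_cons, weight_nil]
        omega
      have e5 : M * (2 * (2 * M) ^ (L.orphans - 1)) = (2 * M) ^ L.orphans := by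
        have : L.orphans = L.orphans - 1 + 1 := by
          have := orphans_link_lt L h2 h1 0 false
          omega
        conv_rhs => rw [this, pow_succ]
        ring
      simp only [weight_append, weight_cons, weight_nil]
      omega
    · simp
  | some d =>
    simp only [reveal]
    split_ifs with h1
    · simp; omega
    · have e1 := hmono (orphans_null_le L a (some d))
      have e2 := hmono (orphans_extend_link_new L a d)
      have e3 : weight (2 * M) (((List.range M).filter
          fun v => v < L.N ∧ L.init v none = none).map fun v => L.link v a d) ≤
          (2 * M) ^ L.orphans := by
        rcases Nat.eq_zero_or_pos L.orphans with h0 | h0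
        · have : ((List.range M).filter fun v => v < L.N ∧ L.init v none = none) = [] := by
            refine List.filter_eq_nil_iff.2 fun v _ hv => ?_
            simp only [decide_eq_true_eq] at hv
            have := orphans_link_lt L hv.1 hv.2 0 false
            omega
          rw [this]
          simp
        · refine (weight_map_le (c := (2 * M) ^ (L.orphans - 1)) _ _ fun v hv => ?_).trans ?_
          · simp only [List.mem_filter, decide_eq_true_eq] at hv
            exact hmono (Nat.le_sub_one_of_lt (orphans_link_lt L hv.2.1 hv.2.2 a d))
          · calc _ ≤ M * (2 * M) ^ (L.orphans - 1) := by
                  gcongr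
                  exact (List.length_filter_le _ _).trans_eq List.length_range
              _ ≤ (2 * M) * (2 * M) ^ (L.orphans - 1) := by gcongr; omega
              _ = (2 * M) ^ L.orphans := by
                  rw [← pow_succ']
                  congr 1
                  omega
      simp only [weight_append, weight_cons, weight_nil]
      omega

theorem weight_move (Q : ℕ) (L : Lazy k) (i : Fin k) (σ : Option Bool) :
    weight Q (L.move i σ) ≤ 1 * Q ^ L.orphans := by
  unfold move
  split
  · simp [setFinger, orphans]
  · simp

theorem weight_swapWith {M : ℕ} (hM : 0 < M) (L : Lazy k) (i : Fin k) (d : Bool) (a : ℕ) :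
    weight (2 * M) (L.swapWith M i d a) ≤ 16 * (2 * M) ^ L.orphans := by
  unfold swapWith
  split
  · next b _ =>
    refine (weight_flatMap (c := 4) _ _ fun L₂ => ?_).trans ?_
    · rw [weight_map]
      · exact weight_reveal hM L₂ b none
      · exact fun _ => rfl
    · have := weight_reveal hM L a none
      omega
  · simp

/-- At most three pointers are explored, each at a factor 4; the swap attains three. -/
theorem weight_step {M : ℕ} (hM : 0 < M) (L : Lazy k) (o : Op k) :
    weight (2 * M) (L.step M o) ≤ 64 * (2 * M) ^ L.orphans := by
  cases o with
  | up i =>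
    have h1 := weight_flatMap (c := 1) (L.reveal M (L.finger i) none) _
      fun L₁ => weight_move (2 * M) L₁ i none
    have h2 := weight_reveal hM L (L.finger i) none
    simp only [step]
    omega
  | down i d =>
    have h1 := weight_flatMap (c := 1) (L.reveal M (L.finger i) (some d)) _
      fun L₁ => weight_move (2 * M) L₁ i (some d)
    have h2 := weight_reveal hM L (L.finger i) (some d)
    simp only [step]
    omega
  | save i =>
    simp only [step, weight_cons, weight_nil, orphans]
    omega
  | load i =>
    simp only [step]
    split
    · simp only [weight_cons, weight_nil, orphans, setFinger]
      omega
    · simp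
  | swap i d =>
    simp only [step]
    split
    · next a _ =>
      have h1 := weight_flatMap (c := 16) (L.reveal M (L.finger i) (some d)) _
        fun L₁ => weight_swapWith hM L₁ i d a
      have h2 := weight_reveal hM L (L.finger i) (some d)
      omega
    · simp
  | link i d =>
    simp only [step]
    split
    · next a _ =>
      have h1 := weight_flatMap (Q := 2 * M) (c := 4) (L.reveal M (L.finger i) (some d))
        (fun L₁ => (L₁.reveal M a none).map fun L₂ => L₂.relink a (L₂.finger i) d) (by
          intro L₁
          rw [weight_map]
          · exact weight_reveal hM L₁ a none
          · exact fun _ => rfl)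
      have h2 := weight_reveal hM L (L.finger i) (some d)
      omega
    · simp

theorem length_allOps : (allOps k).length = k * 9 := by
  simp [allOps]

theorem orphans_serve (mode : FingerMode) (L : Lazy k) (j : Fin k) :
    (L.serve mode j).orphans = L.orphans := by
  cases mode <;> rfl

/-- Nine operations per finger at a factor 64, one serve operation per finger, and the option to
stop: 576k + k + 1 ≤ 578k. -/
theorem weight_next {mode : FingerMode} {M : ℕ} (hM : 0 < M) (hk : 0 < k) (L : Lazy k) :
    weight (2 * M) (L.next mode M) ≤ 578 * k * (2 * M) ^ L.orphans := by
  have h1 := weight_flatMap_le (allOps k) (L.step M) fun o _ => weight_step hM L o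
  have h2 := weight_map_le (Q := 2 * M) (List.finRange k) (L.serve mode)
    fun j _ => (congrArg _ (orphans_serve mode L j)).le
  rw [length_allOps] at h1
  rw [List.length_finRange] at h2
  simp only [next, weight_cons, weight_append]
  nlinarith

theorem weight_reach {mode : FingerMode} {M : ℕ} (hM : 0 < M) (hk : 0 < k) (ℓ : ℕ) (L : Lazy k) :
    weight (2 * M) (L.reach mode M ℓ) ≤ (578 * k) ^ ℓ * (2 * M) ^ L.orphans := by
  induction ℓ generalizing L with
  | zero => simp [reach]
  | succ ℓ ih =>
    calc _ ≤ (578 * k) ^ ℓ * weight (2 * M) (L.next mode M) := weight_flatMap _ _ ih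
      _ ≤ (578 * k) ^ ℓ * (578 * k * (2 * M) ^ L.orphans) := by
        gcongr
        exact weight_next hM hk L
      _ = _ := by ring

theorem mem_reach_trans {mode : FingerMode} {M a b : ℕ} {L L' L'' : Lazy k}
    (h : L' ∈ L.reach mode M a) (h' : L'' ∈ L'.reach mode M b) :
    L'' ∈ L.reach mode M (a + b) := by
  induction a generalizing L with
  | zero =>
    simp only [reach, List.mem_singleton] at h
    subst h
    rwa [Nat.zero_add]
  | succ a ih =>
    rw [reach, List.mem_flatMap] at h
    obtain ⟨L₁, h₁, h₂⟩ := h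
    rw [Nat.add_right_comm, reach, List.mem_flatMap]
    exact ⟨L₁, h₁, ih h₂⟩

theorem mem_reach_self (mode : FingerMode) (M a : ℕ) (L : Lazy k) : L ∈ L.reach mode M a := by
  induction a with
  | zero => simp [reach]
  | succ a ih =>
    rw [reach, List.mem_flatMap]
    exact ⟨L, by simp [next], ih⟩

theorem mem_reach_mono {mode : FingerMode} {M a b : ℕ} {L L' : Lazy k}
    (h : L' ∈ L.reach mode M a) (hab : a ≤ b) : L' ∈ L.reach mode M b := by
  obtain ⟨c, rfl⟩ := Nat.exists_eq_add_of_le hab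
  exact mem_reach_trans h (mem_reach_self mode M c L')

theorem mem_reach_step {mode : FingerMode} {M : ℕ} {L L' : Lazy k} {o : Op k}
    (h : L' ∈ L.step M o) : L' ∈ L.reach mode M 1 := by
  simp only [reach, List.flatMap_singleton', next, List.mem_cons, List.mem_append,
    List.mem_flatMap]
  refine .inr (.inl ⟨o, ?_, h⟩)
  simp only [allOps, List.mem_flatMap, List.mem_finRange, true_and, List.mem_cons,
    List.not_mem_nil, or_false]
  rcases o with i | ⟨i, d⟩ | i | i | ⟨i, d⟩ | ⟨i, d⟩ <;> refine ⟨i, ?_⟩ <;>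
    first | (cases d <;> simp) | simp

theorem mem_reach_serve (mode : FingerMode) (M : ℕ) (L : Lazy k) (j : Fin k) :
    L.serve mode j ∈ L.reach mode M 1 := by
  simp [reach, next]

end Lazy

/-! ### Correctness of partial knowledge -/

namespace Know

variable {n : ℕ} {V : Type}

/-- The knowledge `K` about the nodes named by the numbers below `N` is correct for the tree `T`
if `ι` says which node a number stands for. -/
def Sound (K : Know) (N : ℕ) (ι : ℕ → V) (T : PTree n V) : Prop :=
  ∀ a σ o, K a σ = some o → a < N ∧ (∀ b ∈ o, b < N) ∧ T.ptr (ι a) σ = o.map ι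

variable {K : Know} {N : ℕ} {ι : ℕ → V} {T : PTree n V}

theorem Sound.null (h : K.Sound N ι T) {a : ℕ} {σ : Option Bool} (ha : a < N)
    (hT : T.ptr (ι a) σ = none) : (K.null a σ).Sound N ι T := by
  intro b τ o hb
  unfold Know.null at hb
  split_ifs at hb with h1
  · obtain ⟨rfl, rfl⟩ := h1
    cases hb
    exact ⟨ha, by simp, hT⟩
  · exact h b τ o hb

theorem Sound.link (h : K.Sound N ι T) {v p : ℕ} {d : Bool} (hv : v < N) (hp : p < N)
    (h1 : T.parent (ι v) = some (ι p)) (h2 : T.child (ι p) d = some (ι v)) :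
    (K.link v p d).Sound N ι T := by
  intro b τ o hb
  unfold Know.link at hb
  split_ifs at hb with h3 h4
  · obtain ⟨rfl, rfl⟩ := h3
    cases hb
    exact ⟨hv, by simpa using hp, h1⟩
  · obtain ⟨rfl, rfl⟩ := h4
    cases hb
    exact ⟨hp, by simpa using hv, h2⟩
  · exact h b τ o hb

theorem Sound.extend (h : K.Sound N ι T) (u : V) :
    K.Sound (N + 1) (Function.update ι N u) T := by
  intro a σ o ha
  obtain ⟨h1, h2, h3⟩ := h a σ o ha
  refine ⟨by omega, fun b hb => by have := h2 b hb; omega, ?_⟩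
  rw [Function.update_of_ne (by omega), h3]
  cases o with
  | none => rfl
  | some b =>
    have := h2 b rfl
    rw [Option.map_some, Option.map_some, Function.update_of_ne (by omega)]

theorem swap_apply_of_injOn [DecidableEq V] (inj : ∀ a b, a < N → b < N → ι a = ι b → a = b)
    {v w a : ℕ} (hv : v < N) (hw : w < N) (ha : a < N) :
    ι (Equiv.swap v w a) = Equiv.swap (ι v) (ι w) (ι a) := by
  by_cases h1 : a = v
  · subst h1
    simp
  by_cases h2 : a = w
  · subst h2
    simp
  rw [Equiv.swap_apply_of_ne_of_ne h1 h2, Equiv.swap_apply_of_ne_of_ne]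
  · exact fun h => h1 (inj _ _ ha hv h)
  · exact fun h => h2 (inj _ _ ha hw h)

theorem swap_lt {v w a : ℕ} (hv : v < N) (hw : w < N) (ha : a < N) : Equiv.swap v w a < N := by
  rw [Equiv.swap_apply_def]
  split_ifs <;> assumption

/-- As distinct names stand for distinct nodes, transposing two names corresponds to transposing the
two nodes. -/
theorem Sound.swap [DecidableEq V] (h : K.Sound N ι T)
    (inj : ∀ a b, a < N → b < N → ι a = ι b → a = b) {v w : ℕ} (hv : v < N) (hw : w < N) :
    (K.swap v w).Sound N ι (T.swapSubtrees (ι v) (ι w)) := by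
  intro a σ o ha
  cases σ with
  | none =>
    obtain ⟨h1, h2, h3⟩ := h _ _ _ ha
    have h4 : a < N := by
      have := swap_lt hv hw h1
      rwa [Equiv.swap_apply_self] at this
    refine ⟨h4, h2, ?_⟩
    rw [swap_apply_of_injOn inj hv hw h4] at h3
    exact h3
  | some d =>
    simp only [Know.swap, Option.map_eq_some_iff] at ha
    obtain ⟨o, h0, rfl⟩ := ha
    obtain ⟨h1, h2, h3⟩ := h _ _ _ h0
    refine ⟨h1, ?_, ?_⟩
    · intro b hb
      obtain ⟨c, hc, rfl⟩ := Option.mem_map.1 hb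
      exact swap_lt hv hw (h2 c hc)
    · simp only [PTree.ptr, PTree.swapSubtrees] at h3 ⊢
      rw [h3]
      cases o with
      | none => rfl
      | some b => simp [swap_apply_of_injOn inj hv hw (h2 b rfl)]

theorem Sound.relink [DecidableEq V] (h : K.Sound N ι T)
    (inj : ∀ a b, a < N → b < N → ι a = ι b → a = b) {v p : ℕ} (hv : v < N) (hp : p < N)
    (d : Bool) : (K.relink v p d).Sound N ι (T.relink (ι v) (ι p) d) := by
  intro a σ o ha
  cases σ with
  | none =>
    simp only [Know.relink] at ha
    split_ifs at ha with h1
    · subst h1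
      cases ha
      exact ⟨hv, by simpa using hp, by simp [PTree.ptr, PTree.relink]⟩
    · obtain ⟨h2, h3, h4⟩ := h _ _ _ ha
      refine ⟨h2, h3, ?_⟩
      simp only [PTree.ptr, PTree.relink] at h4 ⊢
      rw [Function.update_of_ne, h4]
      exact fun e => h1 (inj _ _ h2 hv e)
  | some e =>
    simp only [Know.relink] at ha
    split_ifs at ha with h1 h2
    · obtain ⟨rfl, rfl⟩ := h1
      cases ha
      exact ⟨hp, by simpa using hv, by simp [PTree.ptr, PTree.relink]⟩
    · cases ha
      obtain ⟨h3, h4, h5⟩ := h _ _ _ h2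
      refine ⟨h3, by simp, ?_⟩
      simp only [PTree.ptr, PTree.relink, Option.map_some, Option.map_none] at h5 ⊢
      rw [if_neg, if_pos h5]
      rintro ⟨h6, h7⟩
      exact h1 ⟨inj _ _ h3 hp h6, h7⟩
    · obtain ⟨h3, h4, h5⟩ := h _ _ _ ha
      refine ⟨h3, h4, ?_⟩
      simp only [PTree.ptr, PTree.relink] at h5 ⊢
      rw [if_neg, if_neg, h5]
      · rw [h5]
        cases o with
        | none => simp
        | some b =>
          simp only [Option.map_some, Option.some.injEq]
          intro h6
          exact h2 (by rw [ha, inj _ _ (h4 b rfl) hv h6])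
      · rintro ⟨h6, h7⟩
        exact h1 ⟨inj _ _ h3 hp h6, h7⟩

end Know

namespace Lazy

variable {n k : ℕ} {V : Type}

/-- The configuration `s`, reached from the tree `T₀` by serving requests to the keys `w`, is
described by `L`, where the number `a` stands for the node `ι a`. -/
structure Describes (L : Lazy k) (ι : ℕ → V) (T₀ : PTree n V) (s : State n k V)
    (w : List (Fin n)) : Prop where
  consistent_init : T₀.Consistent
  consistent : s.tree.Consistent
  key_eq : s.tree.key = T₀.key
  root_eq : s.tree.root = T₀.root
  inj : ∀ a b, a < L.N → b < L.N → ι a = ι b → a = b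
  sound_init : L.init.Sound L.N ι T₀
  sound : L.cur.Sound L.N ι s.tree
  dom : ∀ a σ, L.cur a σ = none ↔ L.init a σ = none
  parent_of_child : ∀ p d v, L.init p (some d) = some (some v) → L.init v none ≠ none
  child_of_parent : ∀ v p, L.init v none = some (some p) →
    ∃ d, L.init p (some d) = some (some v)
  agree : ∀ u σ, (∀ a, a < L.N → ι a = u → L.init a σ = none) → s.tree.ptr u σ = T₀.ptr u σ
  root_lt : L.root < L.N
  root_map : ι L.root = s.tree.root
  finger_lt : ∀ i, L.finger i < L.N
  finger_map : ∀ i, ι (L.finger i) = s.finger i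
  temp_lt : ∀ a, L.temp = some a → a < L.N
  temp_map : L.temp.map ι = s.temp
  out_lt : ∀ a ∈ L.out, a < L.N
  out_map : L.out.map (fun a => T₀.key (ι a)) = w.map some

/-- The names and pointers explored in `L` are also explored, with the same meaning, in `L'`. -/
structure Extends (L L' : Lazy k) (ι ι' : ℕ → V) : Prop where
  le : L.N ≤ L'.N
  map_eq : ∀ a < L.N, ι' a = ι a
  finger_eq : L'.finger = L.finger
  temp_eq : L'.temp = L.temp
  init_eq : ∀ a σ, L.init a σ ≠ none → L'.init a σ = L.init a σ
  cur_eq : ∀ a σ, L.cur a σ ≠ none → L'.cur a σ = L.cur a σ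

variable {L : Lazy k} {ι : ℕ → V} {T₀ : PTree n V} {s : State n k V} {w : List (Fin n)}

theorem Describes.null (h : L.Describes ι T₀ s w) {a : ℕ} {σ : Option Bool} (ha : a < L.N)
    (hK : L.init a σ = none) (hT : T₀.ptr (ι a) σ = none) :
    (L.null a σ).Describes ι T₀ s w where
  __ := h
  sound_init := h.sound_init.null ha hT
  sound := by
    refine h.sound.null ha ?_
    rw [h.agree, hT]
    intro b hb hba
    rwa [h.inj b a hb ha hba]
  dom b τ := by
    simp only [Lazy.null, Know.null]
    split_ifs
    · simp
    · exact h.dom b τ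
  parent_of_child p d v hp := by
    simp only [Lazy.null, Know.null] at hp ⊢
    split_ifs at hp
    · simp at hp
    · have := h.parent_of_child p d v hp
      split_ifs <;> simp_all
  child_of_parent v p hv := by
    simp only [Lazy.null, Know.null] at hv ⊢
    split_ifs at hv
    · simp at hv
    · obtain ⟨d, hd⟩ := h.child_of_parent v p hv
      refine ⟨d, ?_⟩
      rw [if_neg, hd]
      rintro ⟨rfl, rfl⟩
      simp [hK] at hd
  agree u τ hu := by
    refine h.agree u τ fun b hb hbu => ?_
    have := hu b hb hbu
    simp only [Lazy.null, Know.null] at this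
    split_ifs at this
    exact this

theorem Describes.link (h : L.Describes ι T₀ s w) {v p : ℕ} {d : Bool} (hv : v < L.N)
    (hp : p < L.N) (hKv : L.init v none = none) (hKp : L.init p (some d) = none)
    (hT : T₀.child (ι p) d = some (ι v)) : (L.link v p d).Describes ι T₀ s w where
  __ := h
  sound_init := h.sound_init.link hv hp ((h.consistent_init.parent_iff _ _).2 ⟨d, hT⟩) hT
  sound := by
    have hc : s.tree.child (ι p) d = some (ι v) := by
      rw [← hT]
      exact h.agree (ι p) (some d) fun b hb hbp => by rwa [h.inj b p hb hp hbp]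
    exact h.sound.link hv hp ((h.consistent.parent_iff _ _).2 ⟨d, hc⟩) hc
  dom b τ := by
    simp only [Lazy.link, Know.link]
    split_ifs
    · simp
    · simp
    · exact h.dom b τ
  parent_of_child q e u hq := by
    simp only [Lazy.link, Know.link, reduceCtorEq] at hq ⊢
    split_ifs at hq with h1 h2
    · exact h1.2.elim
    · cases hq
      simp
    · have := h.parent_of_child q e u hq
      split_ifs <;> simp_all
  child_of_parent u q hu := by
    simp only [Lazy.link, Know.link] at hu ⊢
    split_ifs at hu with h1 h2
    · cases hu
      refine ⟨d, ?_⟩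
      rw [if_neg (by simp), if_pos ⟨rfl, rfl⟩, h1.1]
    · simp at h2
    · obtain ⟨e, he⟩ := h.child_of_parent u q hu
      refine ⟨e, ?_⟩
      rw [if_neg (by simp), if_neg, he]
      rintro ⟨rfl, h3⟩
      cases h3
      simp [hKp] at he
  agree u τ hu := by
    refine h.agree u τ fun b hb hbu => ?_
    have := hu b hb hbu
    simp only [Lazy.link, Know.link] at this
    split_ifs at this
    exact this

theorem Describes.init_new (h : L.Describes ι T₀ s w) (σ : Option Bool) :
    L.init L.N σ = none := by
  by_contra hne
  obtain ⟨o, ho⟩ := Option.ne_none_iff_exists'.1 hne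
  exact (h.sound_init _ _ _ ho).1.false

theorem Describes.extend (h : L.Describes ι T₀ s w) {u : V} (hu : ∀ a < L.N, ι a ≠ u) :
    L.extend.Describes (Function.update ι L.N u) T₀ s w := by
  have hup : ∀ a < L.N, Function.update ι L.N u a = ι a := fun a ha =>
    Function.update_of_ne (by omega) _ _
  exact
  { h with
    inj := by
      intro a b ha hb hab
      simp only [Lazy.extend] at ha hb
      by_cases h1 : a = L.N <;> by_cases h2 : b = L.N
      · omega
      · rw [h1, Function.update_self, hup b (by omega)] at hab
        exact absurd hab.symm (hu b (by omega))
      · rw [h2, Function.update_self, hup a (by omega)] at hab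
        exact absurd hab (hu a (by omega))
      · rw [hup a (by omega), hup b (by omega)] at hab
        exact h.inj a b (by omega) (by omega) hab
    sound_init := h.sound_init.extend u
    sound := h.sound.extend u
    agree := fun v τ hv => h.agree v τ fun b hb hbv =>
      hv b (by simp only [Lazy.extend]; omega) (by rw [hup b hb, hbv])
    root_lt := Nat.lt_succ_of_lt h.root_lt
    root_map := (hup _ h.root_lt).trans h.root_map
    finger_lt := fun i => Nat.lt_succ_of_lt (h.finger_lt i)
    finger_map := fun i => (hup _ (h.finger_lt i)).trans (h.finger_map i)
    temp_lt := fun a ha => Nat.lt_succ_of_lt (h.temp_lt a ha)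
    temp_map := by
      rw [← h.temp_map]
      simp only [Lazy.extend]
      cases hL : L.temp with
      | none => rfl
      | some a => simp [hup a (h.temp_lt a hL)]
    out_lt := fun a ha => Nat.lt_succ_of_lt (h.out_lt a ha)
    out_map := by
      rw [← h.out_map]
      exact List.map_congr_left fun a ha => by rw [hup a (h.out_lt a ha)] }

theorem Extends.refl (L : Lazy k) (ι : ℕ → V) : L.Extends L ι ι := by
  constructor <;> simp

theorem Extends.trans {L L' L'' : Lazy k} {ι ι' ι'' : ℕ → V} (h : L.Extends L' ι ι')
    (h' : L'.Extends L'' ι' ι'') : L.Extends L'' ι ι'' where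
  le := h.le.trans h'.le
  map_eq a ha := (h'.map_eq a (ha.trans_le h.le)).trans (h.map_eq a ha)
  finger_eq := h'.finger_eq.trans h.finger_eq
  temp_eq := h'.temp_eq.trans h.temp_eq
  init_eq a σ ha := by
    have h1 := h.init_eq a σ ha
    rw [h'.init_eq a σ (by rwa [h1]), h1]
  cur_eq a σ ha := by
    have h1 := h.cur_eq a σ ha
    rw [h'.cur_eq a σ (by rwa [h1]), h1]

theorem extends_null (h : L.Describes ι T₀ s w) {a : ℕ} {σ : Option Bool}
    (hK : L.init a σ = none) : L.Extends (L.null a σ) ι ι := by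
  constructor
  · rfl
  · simp
  · rfl
  · rfl
  · intro b τ hb
    simp only [null, Know.null]
    rw [if_neg]
    rintro ⟨rfl, rfl⟩
    exact hb hK
  · intro b τ hb
    simp only [null, Know.null]
    rw [if_neg]
    rintro ⟨rfl, rfl⟩
    exact hb ((h.dom b τ).2 hK)

theorem extends_link (h : L.Describes ι T₀ s w) {v p : ℕ} {d : Bool}
    (hKv : L.init v none = none) (hKp : L.init p (some d) = none) :
    L.Extends (L.link v p d) ι ι := by
  constructor
  · rfl
  · simp
  · rfl
  · rfl
  · intro b τ hb
    simp only [link, Know.link]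
    rw [if_neg, if_neg]
    · rintro ⟨rfl, rfl⟩
      exact hb hKp
    · rintro ⟨rfl, rfl⟩
      exact hb hKv
  · intro b τ hb
    simp only [link, Know.link]
    rw [if_neg, if_neg]
    · rintro ⟨rfl, rfl⟩
      exact hb ((h.dom _ _).2 hKp)
    · rintro ⟨rfl, rfl⟩
      exact hb ((h.dom _ _).2 hKv)

theorem extends_extend (L : Lazy k) (ι : ℕ → V) (u : V) :
    L.Extends L.extend ι (Function.update ι L.N u) where
  le := Nat.le_succ _
  map_eq a ha := Function.update_of_ne (by omega) _ _
  finger_eq := rfl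
  temp_eq := rfl
  init_eq _ _ _ := rfl
  cur_eq _ _ _ := rfl

/-- The list of outcomes is complete: whatever the pointer is in the actual initial tree, one
outcome records it. A node met for the first time receives the next free number. -/
theorem exists_mem_reveal {M : ℕ} (h : L.Describes ι T₀ s w) {a : ℕ} (ha : a < L.N)
    (hM : L.N ≤ M) (σ : Option Bool) :
    ∃ L' ∈ L.reveal M a σ, ∃ ι', L'.Describes ι' T₀ s w ∧ L.Extends L' ι ι' ∧
      L'.N ≤ L.N + 1 ∧ L'.init a σ ≠ none := by
  by_cases hK : L.init a σ = none
  swap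
  · refine ⟨L, ?_, ι, h, .refl L ι, by omega, hK⟩
    cases σ <;> simp [reveal, hK]
  by_cases hT : T₀.ptr (ι a) σ = none
  · refine ⟨L.null a σ, ?_, ι, h.null ha hK hT, extends_null h hK, by simp [null], ?_⟩
    · cases σ <;> simp [reveal, hK, ha]
    · simp [null, Know.null]
  obtain ⟨u, hu⟩ := Option.ne_none_iff_exists'.1 hT
  by_cases hnew : ∀ b < L.N, ι b ≠ u
  · have h' := h.extend hnew
    have hx := extends_extend L ι u
    cases σ with
    | none =>
      obtain ⟨d, hd⟩ := (h.consistent_init.parent_iff _ _).1 hu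
      refine ⟨L.extend.link a L.N d, ?_, _, h'.link (Nat.lt_succ_of_lt ha) (Nat.lt_succ_self _)
        hK (h.init_new _) ?_, hx.trans (extends_link h' hK (h.init_new _)), le_rfl, ?_⟩
      · simp only [reveal]
        rw [if_neg (by simpa using hK), if_pos ha]
        cases d <;> simp
      · rw [Function.update_self, Function.update_of_ne (by omega)]
        exact hd
      · simp [link, Know.link]
    | some d =>
      refine ⟨L.extend.link L.N a d, ?_, _, h'.link (Nat.lt_succ_self _) (Nat.lt_succ_of_lt ha)
        (h.init_new _) hK ?_, hx.trans (extends_link h' (h.init_new _) hK), le_rfl, ?_⟩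
      · simp [reveal, hK]
      · rw [Function.update_self, Function.update_of_ne (by omega)]
        exact hu
      · simp [link, Know.link]
  · push Not at hnew
    obtain ⟨b, hb, rfl⟩ := hnew
    cases σ with
    | none =>
      obtain ⟨d, hd⟩ := (h.consistent_init.parent_iff _ _).1 hu
      -- Had this child pointer been explored, it would lead to `a`, and the parent of `a` would be
      -- known.
      have hKb : L.init b (some d) = none := by
        by_contra hne
        obtain ⟨o, ho⟩ := Option.ne_none_iff_exists'.1 hne
        obtain ⟨-, h2, h3⟩ := h.sound_init _ _ _ ho
        have h4 : T₀.ptr (ι b) (some d) = some (ι a) := hd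
        rw [h4] at h3
        obtain ⟨c, rfl, h5⟩ := Option.map_eq_some_iff.1 h3.symm
        rw [h.inj c a (h2 c rfl) ha h5] at ho
        exact h.parent_of_child _ _ _ ho hK
      refine ⟨L.link a b d, ?_, ι, h.link ha hb hK hKb hd, extends_link h hK hKb, by simp [link],
        by simp [link, Know.link]⟩
      simp only [reveal]
      rw [if_neg (by simpa using hK), if_pos ha]
      refine List.mem_append_right _ (List.mem_flatMap.2 ⟨b, by simp; omega, ?_⟩)
      cases d <;> simp
    | some d =>
      -- Had the parent of `b` been explored, it would be `a`, and the child pointer from `a` to `b`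
      -- would be recorded; since the two children of a node differ, that is the pointer being
      -- explored.
      have hKb : L.init b none = none := by
        by_contra hne
        obtain ⟨o, ho⟩ := Option.ne_none_iff_exists'.1 hne
        obtain ⟨-, h2, h3⟩ := h.sound_init _ _ _ ho
        have h4 : T₀.ptr (ι b) none = some (ι a) :=
          (h.consistent_init.parent_iff _ _).2 ⟨d, hu⟩
        rw [h4] at h3
        obtain ⟨c, rfl, h5⟩ := Option.map_eq_some_iff.1 h3.symm
        have hca := h.inj c a (h2 c rfl) ha h5
        subst hca
        obtain ⟨e, he⟩ := h.child_of_parent _ _ ho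
        obtain ⟨-, -, h6⟩ := h.sound_init _ _ _ he
        rw [h.consistent_init.child_inj _ _ _ _ h6 hu] at he
        simp [hK] at he
      refine ⟨L.link b a d, ?_, ι, h.link hb ha hKb hK hu, extends_link h hKb hK, by simp [link],
        by simp [link, Know.link]⟩
      simp only [reveal]
      rw [if_neg (by simpa using hK)]
      refine List.mem_append_right _ (List.mem_map.2 ⟨b, ?_, rfl⟩)
      simp [hb, hKb]
      omega

end Lazy

/-! ### Executions are followed by their descriptions -/

namespace Lazy

variable {n k : ℕ} {V : Type} {L : Lazy k} {ι : ℕ → V} {T₀ : PTree n V} {s : State n k V}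
  {w : List (Fin n)}

theorem Describes.setFinger (h : L.Describes ι T₀ s w) {b : ℕ} (hb : b < L.N) (i : Fin k) :
    (L.setFinger i b).Describes ι T₀ { s with finger := Function.update s.finger i (ι b) } w where
  __ := h
  finger_lt j := by
    simp only [Lazy.setFinger, Function.update_apply]
    split_ifs
    · exact hb
    · exact h.finger_lt j
  finger_map j := by
    simp only [Lazy.setFinger, Function.update_apply]
    split_ifs
    · rfl
    · exact h.finger_map j

/-- Edges are recorded at both ends. Thus, once the parent pointer of a moved subtree is explored,
the child pointer that its removal changes is explored as well. -/
theorem Describes.known_of_child (h : L.Describes ι T₀ s w) {a : ℕ}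
    (hK : L.init a none ≠ none) {u : V} {d : Bool} (hu : T₀.child u d = some (ι a)) :
    ∃ p < L.N, ι p = u ∧ L.init p (some d) ≠ none := by
  obtain ⟨o, ho⟩ := Option.ne_none_iff_exists'.1 hK
  obtain ⟨-, h2, h3⟩ := h.sound_init _ _ _ ho
  have h4 : T₀.ptr (ι a) none = some u := (h.consistent_init.parent_iff _ _).2 ⟨d, hu⟩
  rw [h4] at h3
  obtain ⟨p, rfl, rfl⟩ := Option.map_eq_some_iff.1 h3.symm
  obtain ⟨e, he⟩ := h.child_of_parent _ _ ho
  obtain ⟨-, -, h6⟩ := h.sound_init _ _ _ he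
  rw [h.consistent_init.child_inj _ _ _ _ h6 hu] at he
  exact ⟨p, h2 p rfl, rfl, by simp [he]⟩

theorem Describes.exists_cur (h : L.Describes ι T₀ s w) {a : ℕ} {σ : Option Bool} {v : V}
    (hK : L.init a σ ≠ none) (hv : s.tree.ptr (ι a) σ = some v) :
    ∃ b < L.N, ι b = v ∧ L.cur a σ = some (some b) := by
  obtain ⟨o, ho⟩ := Option.ne_none_iff_exists'.1 (mt (h.dom a σ).1 hK)
  obtain ⟨-, h2, h3⟩ := h.sound _ _ _ ho
  rw [hv] at h3
  obtain ⟨b, rfl, rfl⟩ := Option.map_eq_some_iff.1 h3.symm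
  exact ⟨b, h2 b rfl, rfl, ho⟩

theorem exists_mem_move (h : L.Describes ι T₀ s w) {i : Fin k} {σ : Option Bool} {v : V}
    (hK : L.init (L.finger i) σ ≠ none) (hv : s.tree.ptr (s.finger i) σ = some v) :
    ∃ L' ∈ L.move i σ,
      L'.Describes ι T₀ { s with finger := Function.update s.finger i v } w ∧ L'.N = L.N := by
  rw [← h.finger_map] at hv
  obtain ⟨b, hb, rfl, hc⟩ := h.exists_cur hK hv
  exact ⟨L.setFinger i b, by simp [move, hc], h.setFinger hb i, rfl⟩

variable [DecidableEq V]

/-- Only agreement on unexplored pointers needs an argument: by `Describes.known_of_child`, no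
unexplored child pointer leads to either of the swapped nodes. -/
theorem Describes.swap (h : L.Describes ι T₀ s w) {a b : ℕ} (ha : a < L.N) (hb : b < L.N)
    (hKa : L.init a none ≠ none) (hKb : L.init b none ≠ none) :
    (L.swap a b).Describes ι T₀ { s with tree := s.tree.swapSubtrees (ι a) (ι b) } w where
  __ := h
  consistent := h.consistent.swapSubtrees _ _
  sound := h.sound.swap h.inj ha hb
  dom c σ := by
    cases σ with
    | none =>
      simp only [Lazy.swap, Know.swap, h.dom]
      by_cases h1 : c = a
      · subst h1
        simp [hKa, hKb]
      by_cases h2 : c = b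
      · subst h2
        simp [hKa, hKb]
      rw [Equiv.swap_apply_of_ne_of_ne h1 h2]
    | some d => simp [Lazy.swap, Know.swap, h.dom]
  agree u σ hu := by
    have h0 := h.agree u σ hu
    cases σ with
    | none =>
      rw [← h0]
      simp only [PTree.ptr, PTree.swapSubtrees]
      rw [Equiv.swap_apply_of_ne_of_ne]
      · rintro rfl
        exact hKa (hu a ha rfl)
      · rintro rfl
        exact hKb (hu b hb rfl)
    | some d =>
      have h1 : ∀ c, L.init c none ≠ none → T₀.child u d ≠ some (ι c) := by
        intro c hKc hcu
        obtain ⟨p, hp, hpu, hne⟩ := h.known_of_child hKc hcu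
        exact hne (hu p hp hpu)
      simp only [PTree.ptr, PTree.swapSubtrees] at h0 ⊢
      rw [h0]
      cases hx : T₀.child u d with
      | none => rfl
      | some x =>
        rw [Option.map_some, Equiv.swap_apply_of_ne_of_ne]
        · rintro rfl
          exact h1 a hKa hx
        · rintro rfl
          exact h1 b hKb hx

theorem Describes.relink (h : L.Describes ι T₀ s w) {a p : ℕ} {d : Bool} (ha : a < L.N)
    (hp : p < L.N) (hKa : L.init a none ≠ none) (hKp : L.init p (some d) ≠ none)
    (hnone : s.tree.child (ι p) d = none) :
    (L.relink a p d).Describes ι T₀ { s with tree := s.tree.relink (ι a) (ι p) d } w where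
  __ := h
  consistent := h.consistent.relink _ _ _ hnone
  sound := h.sound.relink h.inj ha hp d
  dom c σ := by
    cases σ with
    | none =>
      simp only [Lazy.relink, Know.relink]
      split_ifs with h1
      · subst h1
        simp [hKa]
      · exact h.dom _ _
    | some e =>
      simp only [Lazy.relink, Know.relink]
      split_ifs with h1 h2
      · obtain ⟨rfl, rfl⟩ := h1
        simp [hKp]
      · have := (h.dom c (some e)).2.mt (by simp [h2])
        simp [this]
      · exact h.dom _ _
  agree u σ hu := by
    have h0 := h.agree u σ hu
    cases σ with
    | none =>
      rw [← h0]
      simp only [PTree.ptr, PTree.relink]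
      rw [Function.update_of_ne]
      rintro rfl
      exact hKa (hu a ha rfl)
    | some e =>
      rw [← h0]
      simp only [PTree.ptr, PTree.relink] at h0 ⊢
      rw [if_neg, if_neg]
      · rw [h0]
        intro hcu
        obtain ⟨q, hq, hqu, hne⟩ := h.known_of_child hKa hcu
        exact hne (hu q hq hqu)
      · rintro ⟨rfl, rfl⟩
        exact hKp (hu p hp rfl)

/-- Every operation on a configuration is matched by a step of its description. -/
theorem exists_mem_step {M : ℕ} {s' : State n k V} {o : Op k} (h : L.Describes ι T₀ s w)
    (hM : L.N + 3 ≤ M) (ho : o.apply s = some s') :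
    ∃ L' ∈ L.step M o, ∃ ι', L'.Describes ι' T₀ s' w ∧ L.N ≤ L'.N ∧ L'.N ≤ L.N + 3 ∧
      ∀ a < L.N, ι' a = ι a := by
  cases o with
  | up i =>
    simp only [Op.apply, Option.map_eq_some_iff] at ho
    obtain ⟨p, hp, rfl⟩ := ho
    obtain ⟨L₁, hL₁, ι₁, h₁, x₁, hN, hK⟩ :=
      exists_mem_reveal h (h.finger_lt i) (by omega : L.N ≤ M) none
    rw [← x₁.finger_eq] at hK
    obtain ⟨L₂, hL₂, h₂, hN₂⟩ := exists_mem_move h₁ hK hp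
    exact ⟨L₂, List.mem_flatMap.2 ⟨L₁, hL₁, hL₂⟩, ι₁, h₂, by have := x₁.le; omega, by omega,
      x₁.map_eq⟩
  | down i d =>
    simp only [Op.apply, Option.map_eq_some_iff] at ho
    obtain ⟨p, hp, rfl⟩ := ho
    obtain ⟨L₁, hL₁, ι₁, h₁, x₁, hN, hK⟩ :=
      exists_mem_reveal h (h.finger_lt i) (by omega : L.N ≤ M) (some d)
    rw [← x₁.finger_eq] at hK
    obtain ⟨L₂, hL₂, h₂, hN₂⟩ := exists_mem_move h₁ hK hp
    exact ⟨L₂, List.mem_flatMap.2 ⟨L₁, hL₁, hL₂⟩, ι₁, h₂, by have := x₁.le; omega, by omega,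
      x₁.map_eq⟩
  | save i =>
    simp only [Op.apply, Option.some.injEq] at ho
    subst ho
    refine ⟨_, List.mem_singleton.2 rfl, ι, ?_, le_rfl, by simp, fun _ _ => rfl⟩
    exact { h with
      temp_lt := fun a ha => by
        cases ha
        exact h.finger_lt i
      temp_map := congrArg some (h.finger_map i) }
  | load i =>
    simp only [Op.apply, Option.map_eq_some_iff] at ho
    obtain ⟨v, hv, rfl⟩ := ho
    have ht := h.temp_map
    rw [hv] at ht
    obtain ⟨a, ha, rfl⟩ := Option.map_eq_some_iff.1 ht
    exact ⟨L.setFinger i a, by simp [step, ha], ι, h.setFinger (h.temp_lt a ha) i, le_rfl,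
      by simp [Lazy.setFinger], fun _ _ => rfl⟩
  | swap i d =>
    simp only [Op.apply, Option.bind_eq_some_iff] at ho
    obtain ⟨v, hv, x, hx, ho⟩ := ho
    split_ifs at ho
    cases ho
    have ht := h.temp_map
    rw [hv] at ht
    obtain ⟨a, ha, rfl⟩ := Option.map_eq_some_iff.1 ht
    have haN := h.temp_lt a ha
    obtain ⟨L₁, hL₁, ι₁, h₁, x₁, hN₁, hK₁⟩ :=
      exists_mem_reveal h (h.finger_lt i) (by omega : L.N ≤ M) (some d)
    have hN₁' := x₁.le
    have hx' : s.tree.ptr (ι₁ (L₁.finger i)) (some d) = some x := by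
      rw [h₁.finger_map]
      exact hx
    rw [← x₁.finger_eq] at hK₁
    obtain ⟨b, hbN, hb, hcur⟩ := h₁.exists_cur hK₁ hx'
    obtain ⟨L₂, hL₂, ι₂, h₂, x₂, hN₂, hK₂⟩ :=
      exists_mem_reveal h₁ (by omega : a < L₁.N) (by omega : L₁.N ≤ M) none
    have hN₂' := x₂.le
    obtain ⟨L₃, hL₃, ι₃, h₃, x₃, hN₃, hK₃⟩ :=
      exists_mem_reveal h₂ (by omega : b < L₂.N) (by omega : L₂.N ≤ M) none
    have hN₃' := x₃.le
    have h₄ := h₃.swap (by omega : a < L₃.N) (by omega : b < L₃.N)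
      (by rwa [x₃.init_eq _ _ hK₂]) hK₃
    have h5 := ((x₁.trans x₂).trans x₃).map_eq
    rw [h5 a haN, (x₂.trans x₃).map_eq b hbN, hb] at h₄
    refine ⟨L₃.swap a b, ?_, ι₃, h₄, by simp only [Lazy.swap]; omega,
      by simp only [Lazy.swap]; omega, h5⟩
    simp only [step, ha]
    refine List.mem_flatMap.2 ⟨L₁, hL₁, ?_⟩
    simp only [swapWith, hcur]
    exact List.mem_flatMap.2 ⟨L₂, hL₂, List.mem_map.2 ⟨L₃, hL₃, rfl⟩⟩
  | link i d =>
    simp only [Op.apply, Option.bind_eq_some_iff] at ho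
    obtain ⟨v, hv, ho⟩ := ho
    split_ifs at ho with hc
    cases ho
    have ht := h.temp_map
    rw [hv] at ht
    obtain ⟨a, ha, rfl⟩ := Option.map_eq_some_iff.1 ht
    have haN := h.temp_lt a ha
    obtain ⟨L₁, hL₁, ι₁, h₁, x₁, hN₁, hK₁⟩ :=
      exists_mem_reveal h (h.finger_lt i) (by omega : L.N ≤ M) (some d)
    have hN₁' := x₁.le
    obtain ⟨L₂, hL₂, ι₂, h₂, x₂, hN₂, hK₂⟩ :=
      exists_mem_reveal h₁ (by omega : a < L₁.N) (by omega : L₁.N ≤ M) none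
    have hN₂' := x₂.le
    rw [← x₁.finger_eq, ← x₂.finger_eq] at hK₁
    have h₃ := h₂.relink (by omega : a < L₂.N) (h₂.finger_lt i) hK₂
      (by rwa [x₂.init_eq _ _ hK₁])
      (by rw [h₂.finger_map]; exact hc.1)
    have h5 := (x₁.trans x₂).map_eq
    rw [h5 a haN, h₂.finger_map] at h₃
    refine ⟨_, ?_, ι₂, h₃, by simp only [Lazy.relink]; omega,
      by simp only [Lazy.relink]; omega, h5⟩
    simp only [step, ha]
    exact List.mem_flatMap.2 ⟨L₁, hL₁, List.mem_map.2 ⟨L₂, hL₂, rfl⟩⟩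

theorem exists_mem_reach_ops {mode : FingerMode} {M : ℕ} {s' : State n k V} {ops : List (Op k)}
    (h : L.Describes ι T₀ s w) (hM : L.N + 3 * ops.length ≤ M)
    (ho : ops.foldlM Op.apply s = some s') :
    ∃ L' ∈ L.reach mode M ops.length, ∃ ι', L'.Describes ι' T₀ s' w ∧ L.N ≤ L'.N ∧
      L'.N ≤ L.N + 3 * ops.length ∧ ∀ a < L.N, ι' a = ι a := by
  induction ops generalizing s L ι with
  | nil =>
    cases ho
    exact ⟨L, by simp [reach], ι, h, le_rfl, by simp, fun _ _ => rfl⟩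
  | cons o ops ih =>
    rw [List.foldlM_cons] at ho
    obtain ⟨s₁, hs₁, hs⟩ := Option.bind_eq_some_iff.1 ho
    simp only [List.length_cons] at hM ⊢
    obtain ⟨L₁, hL₁, ι₁, h₁, hN₁, hN₁', hι₁⟩ := exists_mem_step h (by omega : L.N + 3 ≤ M) hs₁
    obtain ⟨L₂, hL₂, ι₂, h₂, hN₂, hN₂', hι₂⟩ := ih h₁ (by omega) hs
    refine ⟨L₂, ?_, ι₂, h₂, by omega, by omega, fun a ha => ?_⟩
    · rw [Nat.add_comm]
      exact mem_reach_trans (mem_reach_step hL₁) hL₂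
    · rw [hι₂ a (by omega), hι₁ a ha]

omit [DecidableEq V] in
theorem Describes.beginAccess (h : L.Describes ι T₀ s w) (mode : FingerMode) :
    (L.beginAccess mode).Describes ι T₀ (s.beginAccess mode) w := by
  cases mode with
  | transient =>
    exact { h with
      finger_lt := fun _ => h.root_lt
      finger_map := fun _ => h.root_map
      temp_lt := fun a ha => by simp [Lazy.beginAccess] at ha
      temp_map := rfl }
  | persistent =>
    exact { h with
      temp_lt := fun a ha => by simp [Lazy.beginAccess] at ha
      temp_map := rfl }

omit [DecidableEq V] in
theorem Describes.serve (h : L.Describes ι T₀ s w) (mode : FingerMode) {j : Fin k} {x : Fin n}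
    (hx : s.tree.key (s.finger j) = some x) :
    (L.serve mode j).Describes ι T₀ (s.beginAccess mode) (w ++ [x]) := by
  refine Describes.beginAccess ?_ mode
  exact { h with
    out_lt := fun a ha => by
      rcases List.mem_append.1 ha with ha | ha
      · exact h.out_lt a ha
      · rw [List.mem_singleton.1 ha]
        exact h.finger_lt j
    out_map := by
      rw [List.map_append, List.map_append, h.out_map, ← h.key_eq]
      simp [h.finger_map, hx] }

/-- One unit of cost matches one step of the description, the serve step also covering the start of
the next access. Each operation adds at most three names, so names stay below the bound `M`. -/
theorem exists_mem_reach {mode : FingerMode} {M : ℕ} {A : List (Fin n)} {P : List (Plan k)}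
    (h : L.Describes ι T₀ (s.beginAccess mode) w) (hM : L.N + 3 * totalCost P ≤ M)
    (hP : Serves mode s A P) :
    ∃ L' ∈ L.reach mode M (totalCost P), ∃ ι' s', L'.Describes ι' T₀ s' (w ++ A) ∧
      L.N ≤ L'.N ∧ L'.N ≤ L.N + 3 * totalCost P ∧ ∀ a < L.N, ι' a = ι a := by
  induction A generalizing s L ι w P with
  | nil =>
    cases P with
    | nil => exact ⟨L, by simp [totalCost, reach], ι, _, by simpa using h, le_rfl, by simp,
        fun _ _ => rfl⟩
    | cons p P => exact hP.elim
  | cons x A ih =>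
    cases P with
    | nil => exact hP.elim
    | cons p P =>
      obtain ⟨s₁, hs₁, hP⟩ := hP
      obtain ⟨ho, hx⟩ := State.serve_eq_some hs₁
      have hc : totalCost (p :: P) = p.ops.length + 1 + totalCost P := by
        simp [totalCost, Plan.cost]
      rw [hc] at hM ⊢
      obtain ⟨L₁, hL₁, ι₁, h₁, hN₁, hN₁', hι₁⟩ :=
        exists_mem_reach_ops (mode := mode) (M := M) h (by omega) ho
      have h₂ := h₁.serve mode hx
      have hN₂ : (L₁.serve mode p.server).N = L₁.N := by cases mode <;> rfl
      obtain ⟨L₃, hL₃, ι₃, s₃, h₃, hN₃, hN₃', hι₃⟩ := ih h₂ (by omega) hP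
      refine ⟨L₃, mem_reach_trans (mem_reach_trans hL₁ (mem_reach_serve mode M _ _)) hL₃, ι₃, s₃,
        by simpa using h₃, by omega, by omega, fun a ha => ?_⟩
      rw [hι₃ a (by omega), hι₁ a ha]

omit [DecidableEq V] in
-- The second run starts from the initial tree but keeps all names and all knowledge of that tree,
-- so that the nodes served in both runs can be compared and no orphan is created anew.
theorem Describes.restart (h : L.Describes ι T₀ s w) {g : Fin k → ℕ} (hg : ∀ i, g i < L.N) :
    (L.restart g).Describes ι T₀ { tree := T₀, finger := fun i => ι (g i), temp := none } w where
  __ := h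
  consistent := h.consistent_init
  key_eq := rfl
  root_eq := rfl
  sound := h.sound_init
  dom _ _ := Iff.rfl
  agree _ _ _ := rfl
  root_map := h.root_map.trans h.root_eq
  finger_lt := hg
  finger_map _ := rfl
  temp_lt a ha := by simp [Lazy.restart] at ha
  temp_map := rfl

end Lazy

/-! ### Pairs of runs and a bad order for all configurations -/

namespace Lazy

variable {n k : ℕ} {V : Type}

/-- A configuration with no explored pointer. -/
def start (N root : ℕ) (g : Fin k → ℕ) : Lazy k where
  N := N
  root := root
  init := fun _ _ => none
  cur := fun _ _ => none
  finger := g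
  temp := none
  out := []

theorem orphans_start_le (N root : ℕ) (g : Fin k → ℕ) : (start N root g).orphans ≤ N :=
  (Finset.card_filter_le _ _).trans_eq (Finset.card_range _)

theorem orphans_beginAccess (L : Lazy k) (mode : FingerMode) :
    (L.beginAccess mode).orphans = L.orphans := by
  cases mode <;> rfl

theorem beginAccess_N (L : Lazy k) (mode : FingerMode) : (L.beginAccess mode).N = L.N := by
  cases mode <;> rfl

/-- Only the root and the finger locations need names. The coincidences among these at most k + 1
nodes are the only information about the start, and have at most (k + 2)(k + 1)^(k + 1)
possibilities. -/
theorem exists_describes_start {T : PTree n V} (hT : T.Consistent) (f : Fin k → V) :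
    ∃ (N : Fin (k + 2)) (r : Fin (k + 1)) (g : Fin k → Fin (k + 1)) (ι : ℕ → V),
      (∀ i, (g i : ℕ) < N) ∧ (∀ i, ι (g i) = f i) ∧
      (start N r fun i => g i : Lazy k).Describes ι T { tree := T, finger := f, temp := none }
        [] := by
  classical
  set S : Finset V := insert T.root (Finset.univ.image f) with hS
  have hcard : S.card ≤ k + 1 := by
    refine (Finset.card_insert_le _ _).trans ?_
    have := Finset.card_image_le (s := Finset.univ) (f := f)
    rw [Finset.card_univ, Fintype.card_fin] at this
    omega
  have hroot : T.root ∈ S := Finset.mem_insert_self _ _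
  have hf : ∀ i, f i ∈ S := fun i =>
    Finset.mem_insert_of_mem (Finset.mem_image_of_mem f (Finset.mem_univ i))
  let e := S.equivFin
  let ι : ℕ → V := fun a => if h : a < S.card then (e.symm ⟨a, h⟩ : V) else T.root
  have hι : ∀ v (hv : v ∈ S), ι (e ⟨v, hv⟩) = v := fun v hv => by simp [ι]
  have hg : ∀ i, ((e ⟨f i, hf i⟩ : Fin _) : ℕ) < S.card := fun i => (e ⟨f i, hf i⟩).2
  refine ⟨⟨S.card, by omega⟩, ⟨e ⟨T.root, hroot⟩, (e _).2.trans_le hcard⟩,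
    fun i => ⟨e ⟨f i, hf i⟩, (e _).2.trans_le hcard⟩, ι, hg, fun i => hι _ _, ?_⟩
  exact
  { consistent_init := hT
    consistent := hT
    key_eq := rfl
    root_eq := rfl
    inj := by
      intro a b ha hb hab
      simp only [start] at ha hb
      simp only [ι, ha, hb, dif_pos] at hab
      have := e.symm.injective (Subtype.ext hab)
      simpa using this
    sound_init := fun a σ o h => by simp [start] at h
    sound := fun a σ o h => by simp [start] at h
    dom := fun _ _ => Iff.rfl
    parent_of_child := fun p d v h => by simp [start] at h
    child_of_parent := fun v p h => by simp [start] at h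
    agree := fun _ _ _ => rfl
    root_lt := (e ⟨T.root, hroot⟩).2
    root_map := hι _ _
    finger_lt := hg
    finger_map := fun i => hι _ _
    temp_lt := fun a h => by simp [start] at h
    temp_map := rfl
    out_lt := fun a h => by simp [start] at h
    out_map := rfl }

/-- The configurations that arise from two executions of cost at most `D` each, the second one
starting anew from the initial configuration. -/
def twoRuns (mode : FingerMode) (M D N root : ℕ) (g : Fin k → ℕ) : List (Lazy k) :=
  (((start N root g).beginAccess mode).reach mode M D).flatMap fun L =>
    ((L.restart g).beginAccess mode).reach mode M D

/-- Restarting does not change the number of orphans, so both runs together pay only once for the at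
most k + 1 initial ones. -/
theorem length_twoRuns_le {mode : FingerMode} {M : ℕ} (hM : 0 < M) (hk : 0 < k) (D : ℕ)
    {N : ℕ} (hN : N ≤ k + 1) (root : ℕ) (g : Fin k → ℕ) :
    (twoRuns mode M D N root g).length ≤ (578 * k) ^ (2 * D) * (2 * M) ^ (k + 1) := by
  have h1 := weight_flatMap (Q := 2 * M) (c := (578 * k) ^ D)
    (((start N root g).beginAccess mode).reach mode M D)
    (fun L => ((L.restart g).beginAccess mode).reach mode M D) (fun L => by
      refine (weight_reach hM hk D _).trans_eq ?_
      rw [orphans_beginAccess]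
      rfl)
  have h2 := weight_reach (mode := mode) hM hk D ((start N root g).beginAccess mode)
  rw [orphans_beginAccess] at h2
  have h3 : (2 * M) ^ (start N root g : Lazy k).orphans ≤ (2 * M) ^ (k + 1) :=
    Nat.pow_le_pow_right (by omega) ((orphans_start_le N root g).trans hN)
  calc _ ≤ weight (2 * M) (twoRuns mode M D N root g) := length_le_weight (by omega) _
    _ ≤ (578 * k) ^ D * ((578 * k) ^ D * (2 * M) ^ (start N root g : Lazy k).orphans) :=
      h1.trans (Nat.mul_le_mul_left _ h2)
    _ ≤ (578 * k) ^ D * ((578 * k) ^ D * (2 * M) ^ (k + 1)) := by gcongr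
    _ = _ := by ring

/-- Keys are stored at unique nodes and nodes have unique names, so equality of requested keys can
be read off from the names of the serving nodes. -/
theorem Describes.key_inj {L : Lazy k} {ι : ℕ → V} {T₀ : PTree n V} {s : State n k V}
    {w : List (Fin n)} (h : L.Describes ι T₀ s w)
    (hkey : ∀ u v x, T₀.key u = some x → T₀.key v = some x → u = v) {i j : ℕ} {x y : Fin n}
    (hi : w[i]? = some x) (hj : w[j]? = some y) : L.out[i]? = L.out[j]? ↔ x = y := by
  have key : ∀ {i : ℕ} {x : Fin n}, w[i]? = some x → ∃ a < L.N, L.out[i]? = some a ∧ T₀.key (ι a) = some x := by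
    intro i x hi
    have h1 : (L.out.map fun a => T₀.key (ι a))[i]? = some (some x) := by
      rw [h.out_map, List.getElem?_map, hi, Option.map_some]
    rw [List.getElem?_map] at h1
    obtain ⟨a, ha, hx⟩ := Option.map_eq_some_iff.1 h1
    exact ⟨a, h.out_lt a (List.mem_of_getElem? ha), ha, hx⟩
  obtain ⟨a, ha, ha', hax⟩ := key hi
  obtain ⟨b, hb, hb', hby⟩ := key hj
  rw [ha', hb', Option.some.injEq]
  constructor
  · rintro rfl
    exact Option.some.inj (hax.symm.trans hby)
  · rintro rfl
    exact h.inj a b ha hb (hkey _ _ _ hax hby)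

end Lazy

open Lazy in
/-- There is an order `τ` such that no configuration allows to serve requests to given keys at low
cost both in the given order and in the order `τ`. -/
theorem exists_perm_forall_lt_cost (mode : FingerMode) {n k m D M : ℕ} (hk : 0 < k)
    (hM : k + 1 + 6 * D ≤ M)
    (hcount : (k + 2) * (k + 1) ^ (k + 1) * ((578 * k) ^ (2 * D) * (2 * M) ^ (k + 1)) <
      m.factorial) :
    ∃ τ : Equiv.Perm (Fin m), ∀ (V : Type) [DecidableEq V] (s : State n k V),
      s.tree.Consistent →
      (∀ u v x, s.tree.key u = some x → s.tree.key v = some x → u = v) →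
      ∀ x : Fin m → Fin n, Function.Injective x → ∀ P P' : List (Plan k),
        Serves mode s (List.ofFn x) P → Serves mode s (List.ofFn (x ∘ τ)) P' →
        D < totalCost P ∨ D < totalCost P' := by
  classical
  by_contra! hcon
  -- If every order admitted a configuration in which both runs are cheap, every order would be
  -- encoded by an element of some `twoRuns`, among whose outputs the positions `i` and `m + j`
  -- agree exactly if `i = τ j`.
  have main : ∀ τ : Equiv.Perm (Fin m), ∃ (γ : Fin (k + 2) × Fin (k + 1) × (Fin k → Fin (k + 1)))
      (L : Lazy k), L ∈ twoRuns mode M D γ.1 γ.2.1 (fun i => γ.2.2 i) ∧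
      ∀ i j : Fin m, L.out[(i : ℕ)]? = L.out[m + j]? ↔ i = τ j := by
    intro τ
    obtain ⟨V, _, s, hs, hkey, x, hx, P, P', hP, hP', hD, hD'⟩ := hcon τ
    obtain ⟨N, r, g, ι, hgN, hgf, h₀⟩ := exists_describes_start hs s.finger
    have hN := N.2
    have h₁ : ((start N r fun i => g i : Lazy k).beginAccess mode).Describes ι s.tree
        (s.beginAccess mode) [] := by
      have := h₀.beginAccess mode
      cases mode <;> exact this
    have hN₁ : ((start N r fun i => g i : Lazy k).beginAccess mode).N = N := beginAccess_N _ _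
    obtain ⟨L₂, hL₂, ι₂, s₂, h₂, hN₂, hN₂', hι₂⟩ :=
      exists_mem_reach (M := M) h₁ (by omega) hP
    have h₃ : ((L₂.restart fun i => g i).beginAccess mode).Describes ι₂ s.tree
        (s.beginAccess mode) ([] ++ List.ofFn x) := by
      have hg : ∀ i, (g i : ℕ) < L₂.N := fun i => by
        have := hgN i
        omega
      have := (h₂.restart hg).beginAccess mode
      have hf : (fun i => ι₂ (g i)) = s.finger := funext fun i => by
        rw [hι₂ _ (by rw [hN₁]; exact hgN i), hgf]
      rw [hf] at this
      cases mode <;> exact this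
    have hN₃ : ((L₂.restart fun i => g i).beginAccess mode).N = L₂.N := beginAccess_N _ _
    obtain ⟨L₄, hL₄, ι₄, s₄, h₄, -, -, -⟩ :=
      exists_mem_reach (M := M) h₃ (by omega) hP'
    refine ⟨(N, r, g), L₄, ?_, fun i j => ?_⟩
    · exact List.mem_flatMap.2 ⟨L₂, mem_reach_mono hL₂ hD, mem_reach_mono hL₄ hD'⟩
    · rw [h₄.key_inj hkey (x := x i) (y := x (τ j)), hx.eq_iff]
      · rw [List.nil_append, List.getElem?_append_left (by simp)]
        simp
      · rw [List.nil_append, List.getElem?_append_right (by simp)]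
        simp
  choose γ L hL hout using main
  -- The list of serving nodes determines the order, so there would be at least m! such lists.
  have hinj : Function.Injective fun τ => (L τ).out := by
    intro τ τ' h
    ext j
    have h1 := (hout τ (τ j) j).2 rfl
    have h2 : (L τ).out = (L τ').out := h
    rw [h2] at h1
    rw [(hout τ' (τ j) j).1 h1]
  let S := (Finset.univ : Finset (Fin (k + 2) × Fin (k + 1) × (Fin k → Fin (k + 1)))).biUnion
    fun γ => ((twoRuns mode M D γ.1 γ.2.1 (fun i => γ.2.2 i) : List (Lazy k)).map Lazy.out).toFinset
  have h1 : Fintype.card (Equiv.Perm (Fin m)) ≤ S.card := by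
    rw [← Finset.card_univ]
    refine Finset.card_le_card_of_injOn _ (fun τ _ => ?_) hinj.injOn
    simp only [S, Finset.coe_biUnion, Set.mem_iUnion]
    exact ⟨γ τ, by simp, by simpa using ⟨L τ, hL τ, rfl⟩⟩
  have h2 : S.card ≤ ∑ γ : Fin (k + 2) × Fin (k + 1) × (Fin k → Fin (k + 1)),
      (578 * k) ^ (2 * D) * (2 * M) ^ (k + 1) := by
    refine Finset.card_biUnion_le.trans (Finset.sum_le_sum fun γ _ => ?_)
    refine (List.toFinset_card_le _).trans ?_
    rw [List.length_map]
    exact length_twoRuns_le (by omega) hk D (by have := γ.1.2; omega) _ _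
  rw [Finset.sum_const, Finset.card_univ] at h2
  simp only [Fintype.card_prod, Fintype.card_fin, Fintype.card_fun, smul_eq_mul] at h2
  rw [Fintype.card_perm, Fintype.card_fin] at h1
  have h3 : (k + 2) * ((k + 1) * (k + 1) ^ k) = (k + 2) * (k + 1) ^ (k + 1) := by ring
  rw [h3] at h2
  omega

/-! ### Restructuring binary trees at low cost -/

/-- Binary trees with labelled leaves. -/
inductive BT (α : Type) : Type
  | leaf (a : α)
  | node (l r : BT α)

namespace BT

variable {α : Type}

def leaves : BT α → List α
  | leaf a => [a]
  | node l r => l.leaves ++ r.leaves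

/-- The number of internal nodes. -/
def inner : BT α → ℕ
  | leaf _ => 0
  | node l r => l.inner + r.inner + 1

theorem length_leaves (t : BT α) : t.leaves.length = t.inner + 1 := by
  induction t with
  | leaf a => rfl
  | node l r hl hr => simp only [leaves, inner, List.length_append]; omega

/-- `Trans t t' c`: the tree `t` can be transformed into `t'` by a finger that walks from the root
through the tree and back, and performs local changes, at cost at most `c`. -/
inductive Trans : BT α → BT α → ℕ → Prop
  | refl (t : BT α) : Trans t t 0
  | flip (a b : BT α) : Trans (node a b) (node b a) 1
  | exch (a b c : BT α) : Trans (node a (node b c)) (node c (node b a)) 1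
  | left {l l' : BT α} {c : ℕ} (r : BT α) : Trans l l' c → Trans (node l r) (node l' r) (c + 2)
  | right (l : BT α) {r r' : BT α} {c : ℕ} : Trans r r' c → Trans (node l r) (node l r') (c + 2)
  | trans {t t' t'' : BT α} {c c' : ℕ} : Trans t t' c → Trans t' t'' c' → Trans t t'' (c + c')
  | mono {t t' : BT α} {c c' : ℕ} : Trans t t' c → c ≤ c' → Trans t t' c'

namespace Trans

/-- Both elementary moves are reversible at the same cost. Therefore sorting rows apart and
transposing them can be undone for free in the analysis. -/
theorem symm {t t' : BT α} {c : ℕ} (h : Trans t t' c) : Trans t' t c := by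
  induction h with
  | refl t => exact .refl t
  | flip a b => exact .flip b a
  | exch a b c => exact .exch c b a
  | left r _ ih => exact .left r ih
  | right l _ ih => exact .right l ih
  | trans _ _ ih ih' => exact (ih'.trans ih).mono (by omega)
  | mono _ hc ih => exact ih.mono hc

theorem leaves_perm {t t' : BT α} {c : ℕ} (h : Trans t t' c) : t.leaves.Perm t'.leaves := by
  induction h with
  | refl t => exact .refl _
  | flip a b => exact List.perm_append_comm
  | exch a b c =>
    simp only [leaves]
    exact List.perm_append_comm.trans (by
      rw [List.append_assoc]
      exact (List.perm_append_comm_assoc _ _ _))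
  | left r _ ih => exact ih.append_right _
  | right l _ ih => exact ih.append_left _
  | trans _ _ ih ih' => exact ih.trans ih'
  | mono _ _ ih => exact ih

theorem rotateLeft (a b c : BT α) : Trans (node a (node b c)) (node (node a b) c) 5 :=
  ((exch a b c).trans ((flip c (node b a)).trans (.left c (flip b a)))).mono (by omega)

theorem rotateRight (a b c : BT α) : Trans (node (node a b) c) (node a (node b c)) 5 :=
  (rotateLeft a b c).symm

theorem leftComm (a b c : BT α) : Trans (node a (node b c)) (node b (node a c)) 5 :=
  ((exch a b c).trans ((Trans.right c (flip b a)).trans (exch c a b))).mono (by omega)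

/-- This is the transposition of a 2 × 2 array, the local step of `Trans.zip`. -/
theorem interchange (a b c d : BT α) :
    Trans (node (node a b) (node c d)) (node (node a c) (node b d)) 17 :=
  ((rotateRight a b (node c d)).trans
    ((Trans.right a (leftComm b c d)).trans (rotateLeft a c (node b d)))).mono (by omega)

end Trans

/-- The trees of the list `L` hang off a path that ends with the tree `t`. -/
def comb (L : List (BT α)) (t : BT α) : BT α := L.foldr node t

theorem leaves_comb (L : List (BT α)) (t : BT α) :
    (comb L t).leaves = L.flatMap leaves ++ t.leaves := by
  induction L with
  | nil => rfl
  | cons a L ih =>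
    rw [List.flatMap_cons, List.append_assoc, ← ih]
    rfl

/-- Each internal node of `t` is rotated onto the right path once: a rotation costs 5 and walking
along the path 2. -/
theorem Trans.node_comb (t u : BT α) :
    Trans (node t u) (comb (t.leaves.map leaf) u) (7 * t.inner) := by
  induction t generalizing u with
  | leaf a => exact .refl _
  | node a b iha ihb =>
    have h := ((rotateRight a b u).trans (.right a (ihb u))).trans (iha _)
    refine Trans.mono (c := 5 + (7 * b.inner + 2) + 7 * a.inner) ?_ ?_
    · simpa [leaves, comb] using h
    · simp only [inner]
      omega

theorem Trans.exists_comb (t : BT α) :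
    ∃ L d, L ++ [d] = t.leaves ∧ Trans t (comb (L.map leaf) (leaf d)) (7 * t.inner) := by
  induction t with
  | leaf a => exact ⟨[], a, rfl, .refl _⟩
  | node a b _ ihb =>
    obtain ⟨L, d, hL, h⟩ := ihb
    refine ⟨a.leaves ++ L, d, by simp [leaves, ← hL], ?_⟩
    have h' := (Trans.right a h).trans (node_comb a _)
    refine (?_ : Trans _ _ (7 * b.inner + 2 + 7 * a.inner)).mono ?_
    · simpa [comb] using h'
    · simp only [inner]
      omega

/-- Both trees can be flattened to the same path of leaves, and one flattening is reversed. -/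
theorem Trans.of_leaves_eq {t t' : BT α} (h : t.leaves = t'.leaves) :
    Trans t t' (14 * t.leaves.length) := by
  obtain ⟨L, d, hL, h₁⟩ := exists_comb t
  obtain ⟨L', d', hL', h₂⟩ := exists_comb t'
  obtain ⟨rfl, hd⟩ := List.append_inj' (hL.trans (h.trans hL'.symm)) rfl
  cases hd
  refine (h₁.trans h₂.symm).mono ?_
  have := length_leaves t
  have := length_leaves t'
  rw [← h] at this
  omega

/-- The marked trees can be separated from the other ones. -/
theorem Trans.partition (L : List (Bool × BT α)) (s t : BT α) :
    Trans (comb (L.map Prod.snd) (node s t))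
      (node (comb ((L.filter fun x => x.1).map Prod.snd) s)
        (comb ((L.filter fun x => !x.1).map Prod.snd) t)) (7 * L.length) := by
  induction L with
  | nil => exact .refl _
  | cons x L ih =>
    obtain ⟨b, a⟩ := x
    have h := Trans.right a ih
    cases b with
    | true =>
      refine (h.trans (rotateLeft _ _ _)).mono ?_
      rw [List.length_cons]
      omega
    | false =>
      refine (h.trans (leftComm _ _ _)).mono ?_
      rw [List.length_cons]
      omega

/-- The trees `f 0, …, f m` hang off a path. -/
def row : {m : ℕ} → (Fin (m + 1) → BT α) → BT α
  | 0, f => f 0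
  | _ + 1, f => node (f 0) (row (Fin.tail f))

theorem leaves_row {m : ℕ} (x : Fin (m + 1) → α) :
    (row fun i => leaf (x i)).leaves = List.ofFn x := by
  induction m with
  | zero => simp [row, leaves]
  | succ m ih =>
    rw [List.ofFn_succ, ← ih]
    rfl

theorem Trans.zip {m : ℕ} (f g : Fin (m + 1) → BT α) :
    Trans (node (row f) (row g)) (row fun i => node (f i) (g i)) (19 * m) := by
  induction m with
  | zero => exact .refl _
  | succ m ih =>
    exact ((interchange _ _ _ _).trans (.right _ (ih (Fin.tail f) (Fin.tail g)))).mono (by omega)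

/-- Rows are merged one after another into the columns of those below them, so the cost is linear in
the number of entries. -/
theorem Trans.transpose {m : ℕ} (fs : List (Fin (m + 1) → BT α)) (f₀ : Fin (m + 1) → BT α) :
    Trans (comb (fs.map row) (row f₀)) (row fun i => comb (fs.map fun f => f i) (f₀ i))
      ((19 * m + 2) * fs.length) := by
  induction fs with
  | nil => exact .refl _
  | cons f fs ih =>
    refine ((Trans.right (row f) ih).trans (zip f _)).mono ?_
    rw [List.length_cons]
    exact le_of_eq (by ring)

theorem Trans.moveToFront {m : ℕ} (f : Fin (m + 2) → BT α) (p : Fin (m + 2)) :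
    Trans (row f) (node (f p) (row fun i => f (p.succAbove i))) (7 * (m + 1)) := by
  induction m with
  | zero =>
    cases p using Fin.cases with
    | zero => exact (Trans.refl (row f)).mono (by omega)
    | succ q =>
      obtain rfl : q = 0 := Subsingleton.elim _ _
      exact (Trans.flip _ _).mono (by omega)
  | succ m ih =>
    cases p using Fin.cases with
    | zero => exact (Trans.refl (row f)).mono (by omega)
    | succ q =>
      have e : (fun i => f (q.succ.succAbove i)) =
          Fin.cons (f 0) fun i => Fin.tail f (q.succAbove i) := by
        refine funext fun i => ?_
        cases i using Fin.cases with
        | zero => simp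
        | succ i => simp [Fin.tail]
      rw [e]
      exact ((Trans.right (f 0) (ih (Fin.tail f) q)).trans (leftComm _ _ _)).mono (by omega)

theorem exists_perm_succAbove {m : ℕ} (σ : Equiv.Perm (Fin (m + 1))) :
    ∃ τ : Equiv.Perm (Fin m), ∀ i, (σ 0).succAbove (τ i) = σ i.succ := by
  have h : ∀ i : Fin m, ∃ j, (σ 0).succAbove j = σ i.succ := fun i =>
    Fin.exists_succAbove_eq (σ.injective.ne (Fin.succ_ne_zero i))
  choose g hg using h
  have hinj : Function.Injective g := by
    intro i j hij
    have := (hg i).symm.trans ((congrArg _ hij).trans (hg j))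
    exact Fin.succ_injective _ (σ.injective this)
  exact ⟨Equiv.ofBijective g (Finite.injective_iff_bijective.1 hinj), hg⟩

/-- Selection sort: the items are brought to the front one by one. The quadratic cost is affordable
because it is paid once for all rows, with rows no longer than the square root of n. -/
theorem Trans.permute {m : ℕ} (f : Fin (m + 1) → BT α) (σ : Equiv.Perm (Fin (m + 1))) :
    Trans (row f) (row fun i => f (σ i)) (9 * (m + 1) ^ 2) := by
  induction m with
  | zero =>
    have : (fun i => f (σ i)) = f := funext fun i => congrArg f (Fin.ext (by omega))
    rw [this]
    exact (Trans.refl _).mono (by omega)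
  | succ m ih =>
    obtain ⟨τ, hτ⟩ := exists_perm_succAbove σ
    have h := (moveToFront f (σ 0)).trans (.right _ (ih (fun i => f ((σ 0).succAbove i)) τ))
    simp only [hτ] at h
    exact h.mono (by ring_nf; omega)

/-- The marked rows can be permuted, all of them in the same way, at linear cost. -/
theorem Trans.permuteRows {m : ℕ} (σ : Equiv.Perm (Fin (m + 1)))
    (rows : List (Bool × (Fin (m + 1) → BT α))) (f₀ : Fin (m + 1) → BT α) (t : BT α) :
    Trans (comb (rows.map fun r => row r.2) (node (row f₀) t))
      (comb (rows.map fun r => row fun i => r.2 (if r.1 then σ i else i))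
        (node (row fun i => f₀ (σ i)) t))
      (52 * ((m + 1) * rows.length) + 9 * (m + 1) ^ 2 + 2) := by
  set rows₁ := (rows.filter fun r => r.1).map Prod.snd with hrows₁
  have hlen : rows₁.length ≤ rows.length := by
    rw [hrows₁, List.length_map]
    exact List.length_filter_le _ _
  have h₁ := Trans.partition (rows.map fun r => (r.1, row r.2)) (row f₀) t
  have h₂ := Trans.partition
    (rows.map fun r => (r.1, row fun i => r.2 (if r.1 then σ i else i)))
    (row fun i => f₀ (σ i)) t
  have h₄ := transpose (rows₁.map fun f i => f (σ i)) fun i => f₀ (σ i)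
  simp only [List.map_map, Function.comp_def] at h₄
  -- After transposition each column hangs off the path as a single subtree, so one permutation of
  -- subtrees acts on all marked rows simultaneously.
  have h₃ := (transpose rows₁ f₀).trans ((permute _ σ).trans h₄.symm)
  · rw [List.length_map] at h₁ h₂
    have e₁ : ((rows.map fun r => (r.1, row r.2)).filter fun x => x.1).map Prod.snd =
        rows₁.map row := by
      simp [rows₁, List.filter_map, Function.comp_def]
    have e₂ : ((rows.map fun r => (r.1, row fun i => r.2 (if r.1 then σ i else i))).filter
        fun x => x.1).map Prod.snd = (rows₁.map fun f i => f (σ i)).map row := by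
      simp only [rows₁, List.filter_map, Function.comp_def, List.map_map]
      refine List.map_congr_left fun r hr => ?_
      have := (List.mem_filter.1 hr).2
      simp_all
    have e₃ : ((rows.map fun r => (r.1, row fun i => r.2 (if r.1 then σ i else i))).filter
        fun x => !x.1).map Prod.snd =
        ((rows.map fun r => (r.1, row r.2)).filter fun x => !x.1).map Prod.snd := by
      simp only [List.filter_map, Function.comp_def, List.map_map]
      refine List.map_congr_left fun r hr => ?_
      have := (List.mem_filter.1 hr).2
      simp_all
    rw [e₁] at h₁
    rw [e₂, e₃] at h₂
    simp only [List.map_map, Function.comp_def, List.length_map] at h₁ h₂ h₃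
    -- Separate the marked rows, permute them inside the left subtree, and reverse the separation of
    -- the already permuted arrangement; the unmarked parts coincide.
    refine (h₁.trans ((Trans.left _ h₃).trans h₂.symm)).mono ?_
    have : (19 * m + 2) * rows₁.length ≤ (19 * m + 2) * rows.length := by gcongr
    nlinarith

/-- The factor 73 is 14 for arranging the leaves in rows, 52 for `permuteRows` and 7 for flattening.
The row `x₀`, which is always permuted, and the remainder `rest` are the ends of the paths of marked
and unmarked rows, as a binary tree cannot be empty. -/
theorem Trans.exists_comb_permuteRows {m : ℕ} (σ : Equiv.Perm (Fin (m + 1)))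
    (rows : List (Bool × (Fin (m + 1) → α))) (x₀ : Fin (m + 1) → α) {rest : List α}
    (hrest : rest ≠ []) {t : BT α}
    (ht : t.leaves = (rows.flatMap fun r => List.ofFn r.2) ++ (List.ofFn x₀ ++ rest)) :
    ∃ L d, L ++ [d] = (rows.flatMap fun r => List.ofFn fun i => r.2 (if r.1 then σ i else i)) ++
        ((List.ofFn fun i => x₀ (σ i)) ++ rest) ∧
      Trans t (comb (L.map leaf) (leaf d)) (73 * t.leaves.length + 9 * (m + 1) ^ 2 + 2) := by
  obtain ⟨u, hu⟩ : ∃ u : BT α, u.leaves = rest := by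
    refine ⟨comb (rest.dropLast.map leaf) (leaf (rest.getLast hrest)), ?_⟩
    rw [leaves_comb]
    simp only [leaves, List.flatMap_map, List.flatMap_singleton', List.dropLast_append_getLast]
  have h₁ : Trans t (comb ((rows.map fun r => (r.1, fun i => leaf (r.2 i))).map
      fun r => row r.2) (node (row fun i => leaf (x₀ i)) u)) (14 * t.leaves.length) := by
    apply Trans.of_leaves_eq
    rw [ht, leaves_comb]
    simp [leaves, leaves_row, hu, List.flatMap_map]
  have h₂ := permuteRows σ (rows.map fun r => (r.1, fun i => leaf (r.2 i)))
    (fun i => leaf (x₀ i)) u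
  obtain ⟨L, d, hL, h₃⟩ := Trans.exists_comb (comb ((rows.map
    fun r => (r.1, fun i => leaf (r.2 i))).map
      fun r => row fun i => r.2 (if r.1 then σ i else i)) (node (row fun i => leaf (x₀ (σ i))) u))
  refine ⟨L, d, ?_, (h₁.trans (h₂.trans h₃)).mono ?_⟩
  · rw [hL, leaves_comb]
    simp only [leaves, List.flatMap_map, hu, leaves_row]
  · have e := (h₁.leaves_perm.trans h₂.leaves_perm).length_eq
    have e' := length_leaves (comb ((rows.map
      fun r => (r.1, fun i => leaf (r.2 i))).map
      fun r => row fun i => r.2 (if r.1 then σ i else i)) (node (row fun i => leaf (x₀ (σ i))) u))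
    rw [← e] at e'
    have e'' : (m + 1) * rows.length ≤ t.leaves.length := by
      rw [ht]
      simp only [List.length_append, List.length_flatMap, List.length_ofFn, List.map_const',
        List.sum_replicate, smul_eq_mul]
      nlinarith
    rw [List.length_map]
    omega

end BT

/-! ### Carrying out transformations with one finger -/

/-- Binary trees with labelled nodes. -/
inductive NodeTree (V : Type) : Type
  | leaf (v : V)
  | node (v : V) (l r : NodeTree V)

namespace NodeTree

variable {V : Type}

def root : NodeTree V → V
  | leaf v => v
  | node v _ _ => v

def nodes : NodeTree V → List V
  | leaf v => [v]
  | node v l r => v :: (l.nodes ++ r.nodes)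

theorem root_mem (S : NodeTree V) : S.root ∈ S.nodes := by
  cases S <;> simp [root, nodes]

end NodeTree

namespace PTree

variable {n : ℕ} {V : Type}

/-- The subtree rooted at `S.root` has the nodes `S`, and its shape and its keys are given by
`t`. -/
def Represents (T : PTree n V) : NodeTree V → BT (Fin n) → Prop
  | .leaf v, .leaf x => T.key v = some x ∧ ∀ d, T.child v d = none
  | .node v l r, .node a b => T.child v false = some l.root ∧ T.child v true = some r.root ∧
      T.Represents l a ∧ T.Represents r b
  | _, _ => False

theorem Represents.congr {T T' : PTree n V} {S : NodeTree V} {t : BT (Fin n)}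
    (h : T.Represents S t) (hk : T'.key = T.key)
    (hc : ∀ u ∈ S.nodes, ∀ d, T'.child u d = T.child u d) : T'.Represents S t := by
  induction S generalizing t with
  | leaf v =>
    cases t with
    | leaf x => exact ⟨by rw [hk, h.1], fun d => by rw [hc v (by simp [NodeTree.nodes]), h.2]⟩
    | node a b => exact h
  | node v l r ihl ihr =>
    cases t with
    | leaf x => exact h
    | node a b =>
      have hv := hc v (by simp [NodeTree.nodes])
      exact ⟨by rw [hv, h.1], by rw [hv, h.2.1],
        ihl h.2.2.1 fun u hu => hc u (by simp [NodeTree.nodes, hu]),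
        ihr h.2.2.2 fun u hu => hc u (by simp [NodeTree.nodes, hu])⟩

theorem Represents.child_mem {T : PTree n V} {S : NodeTree V} {t : BT (Fin n)}
    (h : T.Represents S t) {u v : V} {d : Bool} (hu : u ∈ S.nodes) (hv : T.child u d = some v) :
    v ∈ S.nodes := by
  induction S generalizing t with
  | leaf w =>
    cases t with
    | leaf x =>
      simp only [NodeTree.nodes, List.mem_singleton] at hu
      subst hu
      simp [h.2] at hv
    | node a b => exact h.elim
  | node w l r ihl ihr =>
    cases t with
    | leaf x => exact h.elim
    | node a b =>
      simp only [NodeTree.nodes, List.mem_cons, List.mem_append] at hu ⊢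
      rcases hu with rfl | hu | hu
      · cases d
        · rw [h.1] at hv
          cases hv
          exact .inr (.inl l.root_mem)
        · rw [h.2.1] at hv
          cases hv
          exact .inr (.inr r.root_mem)
      · exact .inr (.inl (ihl h.2.2.1 hu))
      · exact .inr (.inr (ihr h.2.2.2 hu))

/-- The nodes of the subtree are closed under taking children, so a chain of parents that starts
outside never enters. This supplies the disjointness required by swaps. -/
theorem Represents.not_inSubtree {T : PTree n V} (hT : T.Consistent) {S : NodeTree V}
    {t : BT (Fin n)} (h : T.Represents S t) {u : V} (hu : u ∉ S.nodes) :
    ¬ T.InSubtree u S.root := by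
  intro hs
  induction hs using Relation.ReflTransGen.head_induction_on with
  | refl => exact hu S.root_mem
  | head h₁ _ ih =>
    obtain ⟨d, hd⟩ := (hT.parent_iff _ _).1 h₁
    exact ih fun hc => hu (h.child_mem hc hd)

variable [DecidableEq V]

theorem Consistent.child_swapSubtrees {T : PTree n V} (hT : T.Consistent) {v w p q u : V}
    (hv : T.parent v = some p) (hw : T.parent w = some q) (hp : u ≠ p) (hq : u ≠ q) (d : Bool) :
    (T.swapSubtrees v w).child u d = T.child u d := by
  simp only [PTree.swapSubtrees]
  cases hc : T.child u d with
  | none => rfl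
  | some x =>
    have hx := (hT.parent_iff x u).2 ⟨d, hc⟩
    rw [Option.map_some, Equiv.swap_apply_of_ne_of_ne]
    · rintro rfl
      exact hp (Option.some.inj (hx.symm.trans hv))
    · rintro rfl
      exact hq (Option.some.inj (hx.symm.trans hw))

end PTree

section Realization

variable {n j : ℕ} {V : Type} [DecidableEq V]

theorem foldlM_append_of_eq_some {s s' s'' : State n j V} {ops ops' : List (Op j)}
    (h : ops.foldlM Op.apply s = some s') (h' : ops'.foldlM Op.apply s' = some s'') :
    (ops ++ ops').foldlM Op.apply s = some s'' := by
  rw [List.foldlM_append, h]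
  exact h'

/-- Starting in the configuration `s` with the finger `i` at the root of the subtree `S`, this
subtree can be given the shape `t` by at most `c` operations. -/
def Realizes (i : Fin j) (s : State n j V) (S : NodeTree V) (t : BT (Fin n)) (c : ℕ) : Prop :=
  ∃ (ops : List (Op j)) (s' : State n j V) (S' : NodeTree V), ops.length ≤ c ∧
    ops.foldlM Op.apply s = some s' ∧ s'.tree.Represents S' t ∧ S'.nodes.Perm S.nodes ∧
    S'.root = S.root ∧ s'.finger i = S.root ∧
    ∀ u ∉ S.nodes, ∀ d, s'.tree.child u d = s.tree.child u d

theorem realizes_flip {i : Fin j} {s : State n j V} (hs : s.tree.Consistent) {S : NodeTree V}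
    {a b : BT (Fin n)} (h : s.tree.Represents S (.node a b)) (hS : S.nodes.Nodup)
    (hi : s.finger i = S.root) : Realizes i s S (.node b a) 6 := by
  cases S with
  | leaf v => exact h.elim
  | node v l r =>
    obtain ⟨hl, hr, ha, hb⟩ := h
    simp only [NodeTree.nodes, List.nodup_cons, List.mem_append, not_or,
      List.nodup_append'] at hS
    obtain ⟨⟨hvl, hvr⟩, -, -, hlr⟩ := hS
    simp only [NodeTree.root] at hi
    have hpl : s.tree.parent l.root = some v := (hs.parent_iff _ _).2 ⟨_, hl⟩
    have hpr : s.tree.parent r.root = some v := (hs.parent_iff _ _).2 ⟨_, hr⟩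
    have h1 : ¬ s.tree.InSubtree l.root r.root :=
      hb.not_inSubtree hs fun h => hlr l.root_mem h
    have h2 : ¬ s.tree.InSubtree r.root l.root :=
      ha.not_inSubtree hs fun h => hlr h r.root_mem
    -- Remember the left child, return to its parent, and exchange it with the right child.
    refine ⟨[.down i false, .save i, .up i, .swap i true], ⟨s.tree.swapSubtrees l.root r.root,
      Function.update s.finger i v, some l.root⟩, .node v r l, by simp, ?_, ⟨?_, ?_, ?_, ?_⟩, ?_,
      rfl, by simp [NodeTree.root], ?_⟩
    · simp [List.foldlM_cons, Op.apply, hi, hl, hpl, hr, h1, h2]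
    · simp [PTree.swapSubtrees, hl]
    · simp [PTree.swapSubtrees, hr]
    · exact hb.congr rfl fun u hu => hs.child_swapSubtrees hpl hpr
        (fun h => hvr (h ▸ hu)) (fun h => hvr (h ▸ hu))
    · exact ha.congr rfl fun u hu => hs.child_swapSubtrees hpl hpr
        (fun h => hvl (h ▸ hu)) (fun h => hvl (h ▸ hu))
    · exact List.perm_append_comm.cons v
    · intro u hu
      have : u ≠ v := fun h => hu (by simp [h, NodeTree.nodes])
      exact hs.child_swapSubtrees hpl hpr this this

theorem realizes_exch {i : Fin j} {s : State n j V} (hs : s.tree.Consistent) {S : NodeTree V}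
    {a b c : BT (Fin n)} (h : s.tree.Represents S (.node a (.node b c))) (hS : S.nodes.Nodup)
    (hi : s.finger i = S.root) : Realizes i s S (.node c (.node b a)) 6 := by
  rcases S with v | ⟨v, A, z | ⟨z, B, C⟩⟩
  · exact h.elim
  · exact h.2.2.2.elim
  · obtain ⟨hA, hz, ha, hB, hC, hb, hc⟩ := h
    simp only [NodeTree.root] at hi hz
    simp only [NodeTree.nodes, List.nodup_cons, List.mem_append, not_or, List.mem_cons,
      List.nodup_append', List.disjoint_append_right, List.disjoint_cons_right] at hS
    obtain ⟨⟨hvA, hvz, hvB, hvC⟩, -, ⟨⟨hzB, hzC⟩, -, -, hBC⟩, hzA, hAB, hAC⟩ := hS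
    have hpA : s.tree.parent A.root = some v := (hs.parent_iff _ _).2 ⟨_, hA⟩
    have hpz : s.tree.parent z = some v := (hs.parent_iff _ _).2 ⟨_, hz⟩
    have hpC : s.tree.parent C.root = some z := (hs.parent_iff _ _).2 ⟨_, hC⟩
    have h1 : ¬ s.tree.InSubtree C.root A.root :=
      ha.not_inSubtree hs fun h => hAC h C.root_mem
    have h2 : ¬ s.tree.InSubtree A.root C.root :=
      hc.not_inSubtree hs fun h => hAC A.root_mem h
    have hBC' : B.root ≠ C.root := fun h => hBC B.root_mem (h ▸ C.root_mem)
    have hBA' : B.root ≠ A.root := fun h => hAB A.root_mem (h ▸ B.root_mem)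
    have hzC' : z ≠ C.root := fun h => hzC (h ▸ C.root_mem)
    have hzA' : z ≠ A.root := fun h => hzA (h ▸ A.root_mem)
    -- Remember the right grandchild on the right side, return, and exchange it with the left child;
    -- these six operations give the factor 6 in `BT.Trans.realizes`.
    refine ⟨[.down i true, .down i true, .save i, .up i, .up i, .swap i false],
      ⟨s.tree.swapSubtrees C.root A.root, Function.update s.finger i v, some C.root⟩,
      .node v C (.node z B A), by simp, ?_, ⟨?_, ?_, ?_, ?_, ?_, ?_, ?_⟩, ?_, rfl,
      by simp [NodeTree.root], ?_⟩
    · simp [List.foldlM_cons, Op.apply, hi, hA, hz, hpz, hC, hpC, h1, h2]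
    · simp [PTree.swapSubtrees, hA]
    · change (s.tree.child v true).map _ = some z
      rw [hz, Option.map_some, Equiv.swap_apply_of_ne_of_ne hzC' hzA']
    · exact hc.congr rfl fun u hu => hs.child_swapSubtrees hpC hpA
        (fun h => hzC (h ▸ hu)) (fun h => hvC (h ▸ hu))
    · simp [PTree.swapSubtrees, hB, Equiv.swap_apply_of_ne_of_ne hBC' hBA']
    · simp [PTree.swapSubtrees, hC]
    · exact hb.congr rfl fun u hu => hs.child_swapSubtrees hpC hpA
        (fun h => hzB (h ▸ hu)) (fun h => hvB (h ▸ hu))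
    · exact ha.congr rfl fun u hu => hs.child_swapSubtrees hpC hpA
        (fun h => hzA (h ▸ hu)) (fun h => hvA (h ▸ hu))
    · simp only [NodeTree.nodes]
      classical
      rw [List.perm_iff_count]
      intro x
      simp only [List.count_cons, List.count_append]
      omega
    · intro u hu
      simp only [NodeTree.nodes, List.mem_cons, List.mem_append, not_or] at hu
      exact hs.child_swapSubtrees hpC hpA hu.2.2.1 hu.1

/-- The transformations of trees can be carried out by one finger. -/
theorem BT.Trans.realizes {t t' : BT (Fin n)} {c : ℕ} (h : Trans t t' c) {i : Fin j}
    {s : State n j V} (hs : s.tree.Consistent) {S : NodeTree V} (hr : s.tree.Represents S t)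
    (hS : S.nodes.Nodup) (hi : s.finger i = S.root) : Realizes i s S t' (6 * c) := by
  induction h generalizing s S with
  | refl t => exact ⟨[], s, S, by simp, rfl, hr, .refl _, rfl, hi, fun _ _ _ => rfl⟩
  | flip a b => exact realizes_flip hs hr hS hi
  | exch a b c => exact realizes_exch hs hr hS hi
  | @left l l' c r _ ih =>
    rcases S with v | ⟨v, A, B⟩
    · exact hr.elim
    obtain ⟨hA, hB, ha, hb⟩ := hr
    simp only [NodeTree.root] at hi
    simp only [NodeTree.nodes, List.nodup_cons, List.mem_append, not_or,
      List.nodup_append'] at hS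
    obtain ⟨⟨hvA, hvB⟩, hA', -, hAB⟩ := hS
    obtain ⟨ops, s', S', hlen, hops, hr', hperm, hroot, hfin, hframe⟩ :=
      ih (s := { s with finger := Function.update s.finger i A.root }) hs ha hA' (by simp)
    obtain ⟨hs', hkey, -⟩ := ops_invariant hops hs
    have hv : ∀ d, s'.tree.child v d = s.tree.child v d := hframe v hvA
    have hp : s'.tree.parent A.root = some v := (hs'.parent_iff _ _).2 ⟨_, (hv _).trans hA⟩
    refine ⟨.down i false :: (ops ++ [.up i]),
      { s' with finger := Function.update s'.finger i v }, .node v S' B, ?_, ?_,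
      ⟨?_, ?_, hr', ?_⟩, ?_, rfl, by simp [NodeTree.root], ?_⟩
    · simp only [List.length_cons, List.length_append, List.length_nil]
      omega
    · rw [List.foldlM_cons]
      have h1 : Op.apply s (.down i false) =
          some { s with finger := Function.update s.finger i A.root } := by
        simp [Op.apply, hi, hA]
      rw [h1]
      refine foldlM_append_of_eq_some hops ?_
      simp [List.foldlM_cons, Op.apply, hfin, hp]
    · exact (hv _).trans (by rw [hA, hroot])
    · exact (hv _).trans hB
    · exact hb.congr hkey fun u hu => hframe u fun h => hAB h hu
    · exact (hperm.append_right _).cons v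
    · intro u hu
      simp only [NodeTree.nodes, List.mem_cons, List.mem_append, not_or] at hu
      exact hframe u hu.2.1
  | @right l r r' c _ ih =>
    rcases S with v | ⟨v, A, B⟩
    · exact hr.elim
    obtain ⟨hA, hB, ha, hb⟩ := hr
    simp only [NodeTree.root] at hi
    simp only [NodeTree.nodes, List.nodup_cons, List.mem_append, not_or,
      List.nodup_append'] at hS
    obtain ⟨⟨hvA, hvB⟩, -, hB', hAB⟩ := hS
    obtain ⟨ops, s', S', hlen, hops, hr', hperm, hroot, hfin, hframe⟩ :=
      ih (s := { s with finger := Function.update s.finger i B.root }) hs hb hB' (by simp)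
    obtain ⟨hs', hkey, -⟩ := ops_invariant hops hs
    have hv : ∀ d, s'.tree.child v d = s.tree.child v d := hframe v hvB
    have hp : s'.tree.parent B.root = some v := (hs'.parent_iff _ _).2 ⟨_, (hv _).trans hB⟩
    refine ⟨.down i true :: (ops ++ [.up i]),
      { s' with finger := Function.update s'.finger i v }, .node v A S', ?_, ?_,
      ⟨?_, ?_, ?_, hr'⟩, ?_, rfl, by simp [NodeTree.root], ?_⟩
    · simp only [List.length_cons, List.length_append, List.length_nil]
      omega
    · rw [List.foldlM_cons]
      have h1 : Op.apply s (.down i true) =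
          some { s with finger := Function.update s.finger i B.root } := by
        simp [Op.apply, hi, hB]
      rw [h1]
      refine foldlM_append_of_eq_some hops ?_
      simp [List.foldlM_cons, Op.apply, hfin, hp]
    · exact (hv _).trans hA
    · exact (hv _).trans (by rw [hB, hroot])
    · exact ha.congr hkey fun u hu => hframe u fun h => hAB hu h
    · exact (hperm.append_left _).cons v
    · intro u hu
      simp only [NodeTree.nodes, List.mem_cons, List.mem_append, not_or] at hu
      exact hframe u hu.2.2
  | trans _ _ ih ih' =>
    obtain ⟨ops, s₁, S₁, hlen, hops, hr₁, hperm, hroot, hfin, hframe⟩ := ih hs hr hS hi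
    obtain ⟨ops', s₂, S₂, hlen', hops', hr₂, hperm', hroot', hfin', hframe'⟩ :=
      ih' (ops_invariant hops hs).1 hr₁ (hperm.nodup_iff.2 hS) (hfin.trans hroot.symm)
    refine ⟨ops ++ ops', s₂, S₂, by rw [List.length_append]; omega,
      foldlM_append_of_eq_some hops hops', hr₂, hperm'.trans hperm, hroot'.trans hroot,
      hfin'.trans hroot, fun u hu d => ?_⟩
    rw [hframe' u (mt hperm.mem_iff.1 hu), hframe u hu]
  | mono _ hc ih =>
    obtain ⟨ops, s', S', hlen, h⟩ := ih hs hr hS hi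
    exact ⟨ops, s', S', by omega, h⟩

/-- The subtree that is reached from the root along a path. -/
def BT.descend {α : Type} : BT α → List Bool → Option (BT α)
  | t, [] => some t
  | .leaf _, _ :: _ => none
  | .node l r, d :: ds => (if d then r else l).descend ds

theorem exists_walk {i : Fin j} {s : State n j V} {S : NodeTree V} {t : BT (Fin n)}
    (hr : s.tree.Represents S t) (hi : s.finger i = S.root) {x : Fin n} {path : List Bool}
    (hx : t.descend path = some (.leaf x)) :
    ∃ s', (path.map (Op.down i)).foldlM Op.apply s = some s' ∧ s'.tree = s.tree ∧
      s'.tree.key (s'.finger i) = some x := by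
  induction path generalizing s S t with
  | nil =>
    refine ⟨s, rfl, rfl, ?_⟩
    simp only [BT.descend, Option.some.injEq] at hx
    subst hx
    cases S with
    | leaf v =>
      rw [hi]
      exact hr.1
    | node v l r => exact hr.elim
  | cons d path ih =>
    cases t with
    | leaf y => simp [BT.descend] at hx
    | node a b =>
      cases S with
      | leaf v => exact hr.elim
      | node v A B =>
        obtain ⟨hA, hB, ha, hb⟩ := hr
        simp only [NodeTree.root] at hi
        have hc : s.tree.child v d = some (if d then B.root else A.root) := by
          cases d <;> assumption
        obtain ⟨s', hs', htree, hkey⟩ := ih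
          (s := { s with finger := Function.update s.finger i (if d then B.root else A.root) })
          (S := if d then B else A) (by cases d <;> assumption)
          (by cases d <;> simp) hx
        refine ⟨s', ?_, htree, hkey⟩
        rw [List.map_cons, List.foldlM_cons]
        simpa [Op.apply, hi, hc] using hs'

/-- The tree `T` has the shape `t` and stores the keys as indicated by `t`. -/
structure PTree.HasShape (T : PTree n V) (t : BT (Fin n)) : Prop where
  consistent : T.Consistent
  exists_nodes : ∃ S : NodeTree V, S.nodes.Nodup ∧ S.root = T.root ∧ T.Represents S t

/-- A single access may restructure the tree first: the finger starts at the root, is back there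
after the transformation, and then walks down to the key. -/
theorem exists_plan (i : Fin j) {s : State n j V} {t t' : BT (Fin n)} {c : ℕ}
    (h : s.tree.HasShape t) (ht : BT.Trans t t' c) {x : Fin n} {path : List Bool}
    (hx : t'.descend path = some (.leaf x)) :
    ∃ p s', s.serve .transient x p = some s' ∧ p.cost ≤ 6 * c + path.length + 1 ∧
      s'.tree.HasShape t' := by
  obtain ⟨hs, S, hS, hroot, hr⟩ := h
  obtain ⟨ops, s₁, S₁, hlen, hops, hr₁, hperm, hroot₁, hfin, -⟩ :=
    ht.realizes (i := i) (s := s.beginAccess .transient) hs hr hS hroot.symm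
  obtain ⟨hs₁, -, hroot₂⟩ := ops_invariant hops hs
  obtain ⟨s₂, hops₂, htree, hkey⟩ := exists_walk hr₁ (hfin.trans hroot₁.symm) hx
  refine ⟨⟨ops ++ path.map (Op.down i), i⟩, s₂, ?_, ?_, ?_⟩
  · simp only [State.serve, foldlM_append_of_eq_some hops hops₂, Option.bind_some, hkey, if_true]
  · simp only [Plan.cost, List.length_append, List.length_map]
    omega
  · rw [htree]
    exact ⟨hs₁, S₁, hperm.nodup_iff.2 hS, (hroot₁.trans hroot).trans hroot₂.symm, hr₁⟩

end Realization

/-! ### The shape of a tournament tree -/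

namespace PTree

variable {n : ℕ} {V : Type} {T : PTree n V}

/-- Parents are unique, so a cycle through a node would pass on to each of its ancestors and finally
to the root, which has no parent. -/
theorem IsTournament.not_transGen_self (hT : T.IsTournament) (v : V) :
    ¬ Relation.TransGen (fun a b => T.parent a = some b) v v := by
  intro hv
  have h := hT.connected v
  have key : Relation.TransGen (fun a b => T.parent a = some b) T.root T.root := by
    unfold InSubtree at h
    induction h using Relation.ReflTransGen.head_induction_on with
    | refl => exact hv
    | @head a c hac _ ih =>
      obtain ⟨b, hab, hb⟩ := Relation.TransGen.head'_iff.1 hv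
      cases Option.some.inj (hac.symm.trans hab)
      exact ih (Relation.TransGen.tail' hb hac)
  obtain ⟨b, hb, -⟩ := Relation.TransGen.head'_iff.1 key
  simp [hT.root_parent] at hb

theorem IsTournament.wellFounded_parent [Finite V] (hT : T.IsTournament) :
    WellFounded fun a b => T.parent a = some b := by
  have : IsTrans V (Relation.TransGen fun a b => T.parent a = some b) := inferInstance
  have : Std.Irrefl (Relation.TransGen fun a b => T.parent a = some b) :=
    ⟨hT.not_transGen_self⟩
  exact Subrelation.wf (r := Relation.TransGen fun a b => T.parent a = some b) (fun h => Relation.TransGen.single h)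
    (Finite.wellFounded_of_trans_of_irrefl (Relation.TransGen fun a b => T.parent a = some b))

theorem IsTournament.not_inSubtree_of_child (hT : T.IsTournament) {v a b : V} {d e : Bool}
    (ha : T.child v d = some a) (hb : T.child v e = some b) (hab : a ≠ b) :
    ¬ T.InSubtree a b := by
  intro h
  have hav := (hT.parent_iff _ _).2 ⟨_, ha⟩
  have hbv := (hT.parent_iff _ _).2 ⟨_, hb⟩
  rcases Relation.ReflTransGen.cases_head h with h | ⟨c, hc, h⟩
  · exact hab h
  · cases Option.some.inj (hav.symm.trans hc)
    exact hT.not_transGen_self b (Relation.TransGen.head' hbv h)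

/-- Induction from the leaves upwards, acyclicity making the parent relation well founded on the
finite node set. Sibling subtrees are disjoint because two ancestors of one node are comparable. -/
theorem IsTournament.exists_represents [Finite V] (hT : T.IsTournament) (v : V) :
    ∃ S t, S.root = v ∧ T.Represents S t ∧ S.nodes.Nodup ∧ ∀ u ∈ S.nodes, T.InSubtree u v := by
  induction v using hT.wellFounded_parent.induction with
  | _ v ih =>
    rcases hT.node_cases v with ⟨-, hc⟩ | ⟨hk, hc⟩
    · obtain ⟨a, ha⟩ := Option.ne_none_iff_exists'.1 (hc false)
      obtain ⟨b, hb⟩ := Option.ne_none_iff_exists'.1 (hc true)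
      have hav := (hT.parent_iff _ _).2 ⟨_, ha⟩
      have hbv := (hT.parent_iff _ _).2 ⟨_, hb⟩
      obtain ⟨A, ta, rfl, hA, hAn, hAs⟩ := ih a hav
      obtain ⟨B, tb, rfl, hB, hBn, hBs⟩ := ih b hbv
      have hab : A.root ≠ B.root := fun h => hT.children_ne _ _ ha (h ▸ hb)
      refine ⟨.node v A B, .node ta tb, rfl, ⟨ha, hb, hA, hB⟩, ?_, ?_⟩
      · simp only [NodeTree.nodes, List.nodup_cons, List.mem_append, not_or, List.nodup_append']
        refine ⟨⟨fun h => ?_, fun h => ?_⟩, hAn, hBn, fun u hu hu' => ?_⟩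
        · exact hT.not_transGen_self _ (Relation.TransGen.tail' (hAs v h) hav)
        · exact hT.not_transGen_self _ (Relation.TransGen.tail' (hBs v h) hbv)
        · rcases Relation.ReflTransGen.total_of_right_unique
            (fun _ _ _ h h' => Option.some.inj (h.symm.trans h')) (hAs u hu) (hBs u hu') with h | h
          · exact hT.not_inSubtree_of_child ha hb hab h
          · exact hT.not_inSubtree_of_child hb ha hab.symm h
      · intro u hu
        simp only [NodeTree.nodes, List.mem_cons, List.mem_append] at hu
        rcases hu with rfl | hu | hu
        · exact .refl
        · exact (hAs u hu).tail hav
        · exact (hBs u hu).tail hbv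
    · obtain ⟨x, hx⟩ := Option.ne_none_iff_exists'.1 hk
      refine ⟨.leaf v, .leaf x, rfl, ⟨hx, hc⟩, by simp [NodeTree.nodes], fun u hu => ?_⟩
      simp only [NodeTree.nodes, List.mem_singleton] at hu
      subst hu
      exact .refl

theorem Represents.exists_of_mem_leaves {S : NodeTree V} {t : BT (Fin n)}
    (h : T.Represents S t) {x : Fin n} (hx : x ∈ t.leaves) : ∃ u ∈ S.nodes, T.key u = some x := by
  induction S generalizing t with
  | leaf v =>
    cases t with
    | leaf y =>
      simp only [BT.leaves, List.mem_singleton] at hx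
      subst hx
      exact ⟨v, by simp [NodeTree.nodes], h.1⟩
    | node a b => exact h.elim
  | node v l r ihl ihr =>
    cases t with
    | leaf y => exact h.elim
    | node a b =>
      rcases List.mem_append.1 hx with hx | hx
      · obtain ⟨u, hu, hk⟩ := ihl h.2.2.1 hx
        exact ⟨u, by simp [NodeTree.nodes, hu], hk⟩
      · obtain ⟨u, hu, hk⟩ := ihr h.2.2.2 hx
        exact ⟨u, by simp [NodeTree.nodes, hu], hk⟩

theorem IsTournament.key_inj (hT : T.IsTournament) (u v : V) (x : Fin n) (hu : T.key u = some x)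
    (hv : T.key v = some x) : u = v :=
  (hT.key_unique x).unique hu hv

theorem Represents.nodup_leaves (hT : T.IsTournament) {S : NodeTree V} {t : BT (Fin n)}
    (h : T.Represents S t) (hS : S.nodes.Nodup) : t.leaves.Nodup := by
  induction S generalizing t with
  | leaf v =>
    cases t with
    | leaf y => simp [BT.leaves]
    | node a b => exact h.elim
  | node v l r ihl ihr =>
    cases t with
    | leaf y => exact h.elim
    | node a b =>
      simp only [NodeTree.nodes, List.nodup_cons, List.nodup_append'] at hS
      obtain ⟨-, hl, hr, hd⟩ := hS
      refine List.nodup_append'.2 ⟨ihl h.2.2.1 hl, ihr h.2.2.2 hr, fun x hx hx' => ?_⟩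
      obtain ⟨u, hu, hk⟩ := h.2.2.1.exists_of_mem_leaves hx
      obtain ⟨w, hw, hk'⟩ := h.2.2.2.exists_of_mem_leaves hx'
      rw [hT.key_inj u w x hk hk'] at hu
      exact hd hu hw

theorem Represents.mem_leaves (hT : T.IsTournament) {S : NodeTree V} {t : BT (Fin n)}
    (h : T.Represents S t) {u : V} (hu : u ∈ S.nodes) {x : Fin n} (hx : T.key u = some x) :
    x ∈ t.leaves := by
  induction S generalizing t with
  | leaf v =>
    cases t with
    | leaf y =>
      simp only [NodeTree.nodes, List.mem_singleton] at hu
      subst hu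
      simpa [BT.leaves] using Option.some.inj (hx.symm.trans h.1)
    | node a b => exact h.elim
  | node v l r ihl ihr =>
    cases t with
    | leaf y => exact h.elim
    | node a b =>
      simp only [NodeTree.nodes, List.mem_cons, List.mem_append] at hu
      rcases hu with rfl | hu | hu
      · rcases hT.node_cases u with ⟨hk, -⟩ | ⟨-, hc⟩
        · simp [hk] at hx
        · exact absurd h.1 (by rw [hc]; simp)
      · exact List.mem_append_left _ (ihl h.2.2.1 hu)
      · exact List.mem_append_right _ (ihr h.2.2.2 hu)

/-- The nodes reached from the root are closed under children and every node is connected to the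
root, so all keys occur among the leaves. -/
theorem IsTournament.exists_hasShape [Finite V] (hT : T.IsTournament) :
    ∃ t, T.HasShape t ∧ t.leaves.Nodup ∧ t.leaves.length = n := by
  obtain ⟨S, t, hroot, hr, hS, -⟩ := hT.exists_represents T.root
  have hnd := hr.nodup_leaves hT hS
  refine ⟨t, ⟨hT.consistent, S, hS, hroot, hr⟩, hnd, ?_⟩
  have hall : ∀ u, u ∈ S.nodes := by
    intro u
    have h := hT.connected u
    unfold InSubtree at h
    induction h using Relation.ReflTransGen.head_induction_on with
    | refl => exact hroot ▸ S.root_mem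
    | head h₁ _ ih =>
      obtain ⟨d, hd⟩ := (hT.parent_iff _ _).1 h₁
      exact hr.child_mem ih hd
  have hmem : ∀ x, x ∈ t.leaves := fun x => by
    obtain ⟨u, hu, -⟩ := hT.key_unique x
    exact hr.mem_leaves hT (hall u) hu
  rw [← List.toFinset_card_of_nodup hnd, Finset.eq_univ_of_forall (s := t.leaves.toFinset)
    (by simpa using hmem), Finset.card_univ, Fintype.card_fin]

end PTree

/-! ### Concatenated executions and cheap offline service -/

section ServesTo

variable {n k j : ℕ} {V : Type} [DecidableEq V]

/-- The plans serve the accesses and lead from the first to the second configuration. -/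
def ServesTo (mode : FingerMode) :
    State n k V → List (Fin n) → List (Plan k) → State n k V → Prop
  | s, [], [], s' => s' = s
  | s, x :: A, p :: P, s' => ∃ s₁, s.serve mode x p = some s₁ ∧ ServesTo mode s₁ A P s'
  | _, _, _, _ => False

variable {mode : FingerMode}

theorem serves_iff_exists_servesTo {s : State n k V} {A : List (Fin n)} {P : List (Plan k)} :
    Serves mode s A P ↔ ∃ s', ServesTo mode s A P s' := by
  induction A generalizing s P with
  | nil => cases P <;> simp [Serves, ServesTo]
  | cons x A ih =>
    cases P with
    | nil => simp [Serves, ServesTo]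
    | cons p P =>
      simp only [Serves, ServesTo, ih]
      exact ⟨fun ⟨s₁, h, s', h'⟩ => ⟨s', s₁, h, h'⟩, fun ⟨s', s₁, h, h'⟩ => ⟨s₁, h, s', h'⟩⟩

theorem ServesTo.append {s s' s'' : State n k V} {A B : List (Fin n)} {P Q : List (Plan k)}
    (h : ServesTo mode s A P s') (h' : ServesTo mode s' B Q s'') :
    ServesTo mode s (A ++ B) (P ++ Q) s'' := by
  induction A generalizing s P with
  | nil =>
    cases P with
    | nil =>
      cases h
      exact h'
    | cons p P => exact h.elim
  | cons x A ih =>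
    cases P with
    | nil => exact h.elim
    | cons p P =>
      obtain ⟨s₁, h₁, h₂⟩ := h
      exact ⟨s₁, h₁, ih h₂⟩

theorem ServesTo.unique {s s' s'' : State n k V} {A : List (Fin n)} {P : List (Plan k)}
    (h : ServesTo mode s A P s') (h' : ServesTo mode s A P s'') : s' = s'' := by
  induction A generalizing s P with
  | nil =>
    cases P with
    | nil => exact h.trans h'.symm
    | cons p P => exact h.elim
  | cons x A ih =>
    cases P with
    | nil => exact h.elim
    | cons p P =>
      obtain ⟨s₁, h₁, h₂⟩ := h
      obtain ⟨s₁', h₁', h₂'⟩ := h'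
      cases Option.some.inj (h₁.symm.trans h₁')
      exact ih h₂ h₂'

theorem Serves.of_append {s : State n k V} {A B : List (Fin n)} {P Q : List (Plan k)}
    (hlen : P.length = A.length) (h : Serves mode s (A ++ B) (P ++ Q)) :
    ∃ s', ServesTo mode s A P s' ∧ Serves mode s' B Q := by
  induction A generalizing s P with
  | nil =>
    cases P with
    | nil => exact ⟨s, rfl, h⟩
    | cons p P => simp at hlen
  | cons x A ih =>
    cases P with
    | nil => simp at hlen
    | cons p P =>
      obtain ⟨s₁, h₁, h₂⟩ := h
      obtain ⟨s', h₃, h₄⟩ := ih (by simpa using hlen) h₂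
      exact ⟨s', ⟨s₁, h₁, h₃⟩, h₄⟩

theorem ServesTo.invariant {s s' : State n k V} {A : List (Fin n)} {P : List (Plan k)}
    (h : ServesTo mode s A P s') (hs : s.tree.Consistent) :
    s'.tree.Consistent ∧ s'.tree.key = s.tree.key := by
  induction A generalizing s P with
  | nil =>
    cases P with
    | nil =>
      cases h
      exact ⟨hs, rfl⟩
    | cons p P => exact h.elim
  | cons x A ih =>
    cases P with
    | nil => exact h.elim
    | cons p P =>
      obtain ⟨s₁, h₁, h₂⟩ := h
      obtain ⟨c, hk, -⟩ := State.serve_invariant h₁ hs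
      obtain ⟨c', hk'⟩ := ih h₂ c
      exact ⟨c', hk'.trans hk⟩

@[simp] theorem totalCost_nil : totalCost ([] : List (Plan k)) = 0 := rfl

@[simp] theorem totalCost_cons (p : Plan k) (P : List (Plan k)) :
    totalCost (p :: P) = p.cost + totalCost P := by
  simp [totalCost]

@[simp] theorem totalCost_append (P Q : List (Plan k)) :
    totalCost (P ++ Q) = totalCost P + totalCost Q := by
  simp [totalCost]

theorem length_le_totalCost (P : List (Plan k)) : P.length ≤ totalCost P := by
  induction P with
  | nil => simp
  | cons p P ih =>
    rw [totalCost_cons, List.length_cons, Plan.cost]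
    omega

open BT in
/-- The keys that hang off a path can be served one after another at linear cost. -/
theorem exists_servesTo_node_comb (i : Fin j) (L : List (Fin n)) (d : Fin n) {s : State n j V}
    {a : BT (Fin n)} (h : s.tree.HasShape (node a (comb (L.map leaf) (leaf d)))) :
    ∃ P s' t', ServesTo .transient s (L ++ [d]) P s' ∧ totalCost P ≤ 33 * (L.length + 1) ∧
      s'.tree.HasShape t' ∧ (a.leaves ++ (L ++ [d])).Perm t'.leaves := by
  induction L generalizing a s with
  | nil =>
    obtain ⟨p, s', hs, hp, h'⟩ := exists_plan i h (.refl _) (x := d) (path := [true])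
      (by simp [descend, comb])
    refine ⟨[p], s', _, ⟨s', hs, rfl⟩, ?_, h', .refl _⟩
    simp at hp ⊢
    omega
  | cons x L ih =>
    -- One rotation moves the next key into the left subtree of served keys, at depth two, and
    -- shortens the path. The cost is at most 6 · 5 + 2 + 1 = 33.
    obtain ⟨p, s₁, hs, hp, h₁⟩ := exists_plan i h (Trans.rotateLeft _ _ _) (x := x)
      (path := [false, true]) (by simp [descend])
    obtain ⟨P, s', t', hs', hP, h', hperm⟩ := ih h₁
    refine ⟨p :: P, s', t', ⟨s₁, hs, hs'⟩, ?_, h', ?_⟩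
    · simp at hp ⊢
      omega
    · simpa [leaves] using hperm

open BT in
-- The first access pays for the whole restructuring and serves the left child of the root; with a
-- nonempty `L` this child is the first key of the path.
theorem exists_servesTo_of_trans (i : Fin j) {L : List (Fin n)} {d : Fin n} {s : State n j V}
    {t : BT (Fin n)} {c : ℕ} (h : s.tree.HasShape t)
    (ht : Trans t (comb (L.map leaf) (leaf d)) c) (hL : L ≠ []) :
    ∃ P s' t', ServesTo .transient s (L ++ [d]) P s' ∧
      totalCost P ≤ 6 * c + 33 * (L.length + 1) ∧
      s'.tree.HasShape t' ∧ (L ++ [d]).Perm t'.leaves := by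
  cases L with
  | nil => exact absurd rfl hL
  | cons x L =>
    obtain ⟨p, s₁, hs, hp, h₁⟩ := exists_plan i h ht (x := x) (path := [false])
      (by simp [descend, comb])
    obtain ⟨P, s', t', hs', hP, h', hperm⟩ := exists_servesTo_node_comb i L d h₁
    refine ⟨p :: P, s', t', ⟨s₁, hs, hs'⟩, ?_, h', by simpa [leaves] using hperm⟩
    simp at hp ⊢
    omega

end ServesTo

/-! ### The adversary -/

section Adversary

variable {n k j m : ℕ} {V : Type} [DecidableEq V] {mode : FingerMode}

omit [DecidableEq V] in
theorem OnlineAlgorithm.plansFrom_append (alg : OnlineAlgorithm n k) (past A B : List (Fin n)) :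
    alg.plansFrom past (A ++ B) = alg.plansFrom past A ++ alg.plansFrom (past ++ A) B := by
  induction A generalizing past with
  | nil => simp [plansFrom]
  | cons x A ih => simp [plansFrom, ih]

theorem OnlineAlgorithm.length_plansFrom (alg : OnlineAlgorithm n k) (past A : List (Fin n)) :
    (alg.plansFrom past A).length = A.length := by
  induction A generalizing past with
  | nil => rfl
  | cons x A ih => simp [plansFrom, ih]

/-- After the accesses `past`, the algorithm serves every access sequence from the configuration
`s`. -/
def OnlineAlgorithm.CorrectFrom (alg : OnlineAlgorithm n k) (mode : FingerMode)
    (past : List (Fin n)) (s : State n k V) : Prop :=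
  ∀ A : List (Fin n), Serves mode s A (alg.plansFrom past A)

/-- Correctness is inherited by the configuration reached after `A`, since executions are
deterministic. This lets the adversary proceed row by row and block by block. -/
theorem OnlineAlgorithm.CorrectFrom.exists_servesTo {alg : OnlineAlgorithm n k}
    {past : List (Fin n)} {s : State n k V} (h : alg.CorrectFrom mode past s)
    (A : List (Fin n)) :
    ∃ s', ServesTo mode s A (alg.plansFrom past A) s' ∧ alg.CorrectFrom mode (past ++ A) s' := by
  obtain ⟨s', hs'⟩ := serves_iff_exists_servesTo.1 (h A)
  refine ⟨s', hs', fun B => ?_⟩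
  have hB := h (A ++ B)
  rw [alg.plansFrom_append] at hB
  obtain ⟨s'', h₁, h₂⟩ := Serves.of_append (alg.length_plansFrom past A) hB
  rwa [hs'.unique h₁]

/-- The order `τ` is as in `exists_perm_forall_lt_cost`. -/
def Separating (mode : FingerMode) (n k D : ℕ) (τ : Equiv.Perm (Fin m)) : Prop :=
  ∀ (V : Type) [DecidableEq V] (s : State n k V), s.tree.Consistent →
    (∀ u v x, s.tree.key u = some x → s.tree.key v = some x → u = v) →
    ∀ x : Fin m → Fin n, Function.Injective x → ∀ P P' : List (Plan k),
      Serves mode s (List.ofFn x) P → Serves mode s (List.ofFn (x ∘ τ)) P' →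
      D < totalCost P ∨ D < totalCost P'

/-- The order of each row is decided after the preceding ones: the two candidate continuations start
from the same online configuration, so one of them costs more than D. -/
theorem Separating.exists_costly {D : ℕ} {τ : Equiv.Perm (Fin m)}
    (hτ : Separating mode n k D τ) (rows : List (Fin m → Fin n))
    (hrows : ∀ x ∈ rows, Function.Injective x) {alg : OnlineAlgorithm n k} {past : List (Fin n)}
    {s : State n k V} (hs : s.tree.Consistent)
    (hkey : ∀ u v x, s.tree.key u = some x → s.tree.key v = some x → u = v)
    (h : alg.CorrectFrom mode past s) :
    ∃ rows' : List (Bool × (Fin m → Fin n)), rows'.map Prod.snd = rows ∧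
      rows.length * (D + 1) ≤ totalCost (alg.plansFrom past
        (rows'.flatMap fun r => List.ofFn fun i => r.2 (if r.1 then τ i else i))) := by
  induction rows generalizing past s with
  | nil => exact ⟨[], rfl, by simp⟩
  | cons x rows ih =>
    obtain ⟨b, hb⟩ : ∃ b : Bool, D < totalCost (alg.plansFrom past
        (List.ofFn fun i => x (if b then τ i else i))) := by
      rcases hτ V s hs hkey x (hrows x (by simp)) _ _ (h _) (h _) with h' | h'
      · exact ⟨false, by simpa using h'⟩
      · exact ⟨true, by simpa [Function.comp_def] using h'⟩
    obtain ⟨s', hs', h'⟩ := h.exists_servesTo (List.ofFn fun i => x (if b then τ i else i))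
    obtain ⟨hc, hk⟩ := hs'.invariant hs
    obtain ⟨rows', hmap, hcost⟩ := ih (fun y hy => hrows y (by simp [hy])) hc
      (by rwa [hk]) h'
    refine ⟨(b, x) :: rows', by simp [hmap], ?_⟩
    rw [List.flatMap_cons, alg.plansFrom_append, totalCost_append, List.length_cons]
    nlinarith

theorem exists_rows {α : Type} (m h : ℕ) (L : List α) (hL : L.Nodup) (hlen : h * m ≤ L.length) :
    ∃ (rows : List (Fin m → α)) (rest : List α), rows.length = h ∧
      (∀ x ∈ rows, Function.Injective x) ∧ L = rows.flatMap List.ofFn ++ rest := by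
  induction h generalizing L with
  | zero => exact ⟨[], L, rfl, by simp, by simp⟩
  | succ h ih =>
    have hm : m ≤ L.length := by nlinarith
    obtain ⟨rows, rest, h₁, h₂, h₃⟩ := ih (L.drop m) (hL.sublist (List.drop_sublist _ _))
      (by rw [List.length_drop]; exact Nat.le_sub_of_add_le (by linarith))
    have hof : List.ofFn (fun i : Fin m => L[i]) = L.take m := by
      refine List.ext_getElem (by simp [hm]) fun i _ _ => by simp
    refine ⟨(fun i : Fin m => L[i]) :: rows, rest, by simp [h₁], ?_, ?_⟩
    · intro x hx
      rcases List.mem_cons.1 hx with rfl | hx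
      · rw [← List.nodup_ofFn, hof]
        exact hL.sublist (List.take_sublist _ _)
      · exact h₂ x hx
    · rw [List.flatMap_cons, hof, List.append_assoc, ← h₃, List.take_append_drop]

open BT in
/-- Whatever the configurations of the online and the offline algorithm, there is an order of the
keys that is expensive for the former and cheap for the latter. -/
theorem Separating.exists_block {D h : ℕ} {τ : Equiv.Perm (Fin (m + 1))}
    (hτ : Separating mode n k D τ) (hm : (m + 1) ^ 2 ≤ n) (hh : (h + 1) * (m + 1) < n)
    {alg : OnlineAlgorithm n k} {past : List (Fin n)} {s : State n k V}
    (hs : s.tree.Consistent)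
    (hkey : ∀ u v x, s.tree.key u = some x → s.tree.key v = some x → u = v)
    (hcor : alg.CorrectFrom mode past s) (i : Fin j) {s₀ : State n j V} {t : BT (Fin n)}
    (ht : s₀.tree.HasShape t) (hnd : t.leaves.Nodup) (hlen : t.leaves.length = n) :
    ∃ A : List (Fin n), A.Nodup ∧ A.length = n ∧
      h * (D + 1) ≤ totalCost (alg.plansFrom past A) ∧
      ∃ P s₁ t', ServesTo .transient s₀ A P s₁ ∧ totalCost P ≤ 537 * n ∧
        s₁.tree.HasShape t' ∧ A.Perm t'.leaves := by
  obtain ⟨rows, rest, hrows, hinj, heq⟩ :=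
    exists_rows (m + 1) h t.leaves hnd (by rw [hlen]; nlinarith)
  have hl := congrArg List.length heq
  simp only [hlen, List.length_append, List.length_flatMap, List.length_ofFn, List.map_const',
    List.sum_replicate, smul_eq_mul, hrows] at hl
  -- One further row is split off and always permuted. The strict inequality `hh` leaves at least
  -- one more key.
  obtain ⟨x₀, rest', h₀, -, heq'⟩ := exists_rows (m + 1) 1 rest
    (hnd.sublist (heq ▸ List.sublist_append_right _ _)) (by nlinarith)
  obtain ⟨x₀, rfl⟩ := List.length_eq_one_iff.1 h₀
  have hl' := congrArg List.length heq'
  simp only [List.length_append, List.flatMap_singleton, List.length_ofFn] at hl'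
  have hrest : rest' ≠ [] := by
    rintro rfl
    simp only [List.length_nil] at hl'
    nlinarith
  obtain ⟨rows', hmap, hcost⟩ := hτ.exists_costly rows hinj hs hkey hcor
  obtain ⟨L, d, hLd, htrans⟩ := Trans.exists_comb_permuteRows τ rows' x₀ hrest (t := t) (by
    rw [heq, heq', ← hmap]
    simp [List.flatMap_map])
  have hLt : (L ++ [d]).Perm t.leaves := by
    have := htrans.leaves_perm
    rw [leaves_comb] at this
    simpa [leaves, List.flatMap_map] using this.symm
  have hLlen := hLt.length_eq
  rw [List.length_append, List.length_singleton, hlen] at hLlen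
  have hL : L ≠ [] := by
    rintro rfl
    simp only [List.length_nil] at hLlen
    nlinarith
  obtain ⟨P, s₁, t', hP, hPcost, ht', hperm⟩ := exists_servesTo_of_trans i ht htrans hL
  refine ⟨L ++ [d], hLt.nodup_iff.2 hnd, by simpa using hLlen, ?_, P, s₁, t', hP, ?_, ht', hperm⟩
  · rw [hLd, alg.plansFrom_append, totalCost_append, ← hrows]
    omega
  -- With (m + 1)² ≤ n the cost is at most 6(73n + 9n + 2) + 33n = 525n + 12 ≤ 537n.
  · rw [hlen] at hPcost
    nlinarith

open BT in
-- Every access costs at least one operation, so the leaf order of the offline tree already forces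
-- online cost n.
theorem exists_block_trivial (hn : 2 ≤ n) {alg : OnlineAlgorithm n k} {past : List (Fin n)}
    (i : Fin j) {s₀ : State n j V} {t : BT (Fin n)} (ht : s₀.tree.HasShape t)
    (hnd : t.leaves.Nodup) (hlen : t.leaves.length = n) :
    ∃ A : List (Fin n), A.Nodup ∧ A.length = n ∧
      n ≤ totalCost (alg.plansFrom past A) ∧
      ∃ P s₁ t', ServesTo .transient s₀ A P s₁ ∧ totalCost P ≤ 537 * n ∧
        s₁.tree.HasShape t' ∧ A.Perm t'.leaves := by
  obtain ⟨L, d, hLd, htrans⟩ := Trans.exists_comb t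
  have hLlen := congrArg List.length hLd
  rw [List.length_append, List.length_singleton, hlen] at hLlen
  have hL : L ≠ [] := by
    rintro rfl
    simp only [List.length_nil] at hLlen
    omega
  obtain ⟨P, s₁, t', hP, hPcost, ht', hperm⟩ := exists_servesTo_of_trans i ht htrans hL
  refine ⟨L ++ [d], hLd ▸ hnd, by simpa using hLlen, ?_, P, s₁, t', hP, ?_, ht', hperm⟩
  · refine (length_le_totalCost _).trans' ?_
    rw [alg.length_plansFrom, hLd, hlen]
  · have := length_leaves t
    omega

end Adversary

/-! ### Estimates -/

/-- The term q^q / q! of the exponential series is at most e^q. -/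
theorem log_factorial_ge {q : ℕ} (hq : 0 < q) :
    q * Real.log q - q ≤ Real.log (q.factorial) := by
  have h := Real.pow_div_factorial_le_exp (q : ℝ) (by positivity) q
  have hf : (0 : ℝ) < q.factorial := by exact_mod_cast q.factorial_pos
  have hq' : (0 : ℝ) < q := by exact_mod_cast hq
  have h' := Real.log_le_log (by positivity) h
  rw [Real.log_exp, Real.log_div (by positivity) (by positivity), Real.log_pow] at h'
  linarith

theorem two_le_log_of_sixteen_le {q : ℕ} (hq : 16 ≤ q) : 2 ≤ Real.log q := by
  have h1 : Real.log 16 ≤ Real.log q := Real.log_le_log (by norm_num) (by exact_mod_cast hq)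
  have h2 : Real.log 16 = 4 * Real.log 2 := by
    rw [show (16 : ℝ) = 2 ^ 4 by norm_num, Real.log_pow]
    norm_num
  have := Real.log_two_gt_d9
  linarith

theorem log_max_two_ge (k : ℕ) : 0.69 ≤ Real.log (max k 2 : ℕ) := by
  have h : Real.log 2 ≤ Real.log (max k 2 : ℕ) :=
    Real.log_le_log (by norm_num) (by exact_mod_cast le_max_right k 2)
  have := Real.log_two_gt_d9
  linarith

theorem log_mul_le {a b k : ℕ} (ha : 0 < a) (hab : a ≤ 2 ^ b) (hk : 0 < k) :
    Real.log (a * k : ℕ) ≤ (b + 1) * Real.log (max k 2 : ℕ) := by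
  have h : a * k ≤ (max k 2) ^ (b + 1) := by
    rw [pow_succ]
    exact Nat.mul_le_mul (hab.trans (Nat.pow_le_pow_left (le_max_right k 2) b)) (le_max_left k 2)
  have h' : Real.log (a * k : ℕ) ≤ Real.log ((max k 2 : ℕ) ^ (b + 1) : ℕ) :=
    Real.log_le_log (by exact_mod_cast Nat.mul_pos ha hk) (by exact_mod_cast h)
  rw [Nat.cast_pow, Real.log_pow] at h'
  exact_mod_cast h'

/-- There are fewer pairs of cheap executions than orders of `q` keys. -/
theorem count_lt_factorial {q k D : ℕ} (hq : 16 ≤ q) (hk : 0 < k) (hkq : 20 * (k + 2) ≤ q)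
    (hD : D * (88 * Real.log (max k 2 : ℕ)) ≤ q * Real.log q) :
    (k + 2) * (k + 1) ^ (k + 1) *
      ((578 * k) ^ (2 * D) * (2 * (k + 1 + 6 * D)) ^ (k + 1)) < q.factorial := by
  have hq' : (0 : ℝ) < q := by exact_mod_cast (by omega : 0 < q)
  have hlq := two_le_log_of_sixteen_le hq
  have hlK := log_max_two_ge k
  have hDq : D ≤ q ^ 2 := by
    have h1 : Real.log q ≤ q := (Real.log_le_sub_one_of_pos hq').trans (by linarith)
    have h2 : (D : ℝ) ≤ (q : ℝ) ^ 2 := by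
      have : (D : ℝ) * 1 ≤ D * (88 * Real.log (max k 2 : ℕ)) := by
        gcongr
        linarith
      nlinarith
    exact_mod_cast h2
  have hM : 2 * (k + 1 + 6 * D) ≤ q ^ 3 := by nlinarith
  have h1 : (k + 2) * (k + 1) ^ (k + 1) * ((578 * k) ^ (2 * D) * (2 * (k + 1 + 6 * D)) ^ (k + 1))
      ≤ q ^ (4 * (k + 1) + 1) * (578 * k) ^ (2 * D) := by
    calc _ ≤ q * q ^ (k + 1) * ((578 * k) ^ (2 * D) * (q ^ 3) ^ (k + 1)) := by
          gcongr <;> omega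
      _ = _ := by ring
  refine h1.trans_lt ?_
  have h2 := log_mul_le (a := 578) (b := 10) (k := k) (by norm_num) (by norm_num) hk
  have h3 : (0 : ℝ) < (578 * k : ℕ) := by exact_mod_cast (by omega : 0 < 578 * k)
  have h4 : Real.log ((q ^ (4 * (k + 1) + 1) * (578 * k) ^ (2 * D) : ℕ) : ℝ) <
      Real.log (q.factorial) := by
    refine lt_of_lt_of_le ?_ (log_factorial_ge (by omega))
    rw [Nat.cast_mul, Nat.cast_pow, Nat.cast_pow, Real.log_mul (by positivity) (by positivity),
      Real.log_pow, Real.log_pow]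
    -- In units of q log q, the polynomial factors take at most 1/5 and the operations at most 1/4,
    -- while log(q!) is at least 1/2 because log q ≥ 2.
    have h5 : ((4 * (k + 1) + 1 : ℕ) : ℝ) ≤ q / 5 := by
      have : 5 * (4 * (k + 1) + 1) ≤ q := by omega
      have : ((5 * (4 * (k + 1) + 1) : ℕ) : ℝ) ≤ q := by exact_mod_cast this
      push_cast at this ⊢
      linarith
    have h6 : ((4 * (k + 1) + 1 : ℕ) : ℝ) * Real.log q ≤ q / 5 * Real.log q := by gcongr
    have h7 : ((2 * D : ℕ) : ℝ) * Real.log (578 * k : ℕ) ≤ q * Real.log q / 4 := by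
      calc _ ≤ ((2 * D : ℕ) : ℝ) * ((10 + 1) * Real.log (max k 2 : ℕ)) := by
            gcongr
            exact_mod_cast h2
        _ = D * (88 * Real.log (max k 2 : ℕ)) / 4 := by push_cast; ring
        _ ≤ _ := by linarith
    nlinarith
  have h8 := (Real.log_lt_log_iff (by positivity) (by positivity)).1 h4
  exact_mod_cast h8

/-- Either there are so many fingers that the claimed bound is trivial, or the keys can be divided
into rows that are expensive for every online algorithm. -/
theorem exists_parameters {n k : ℕ} (hn : 65536 ≤ n) (hk : 0 < k) :
    1 / 1056 * (Real.log n / Real.log (max k 2 : ℕ)) ≤ 1 ∨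
    ∃ m h D : ℕ, (m + 1) ^ 2 ≤ n ∧ (h + 1) * (m + 1) < n ∧
      (k + 2) * (k + 1) ^ (k + 1) *
        ((578 * k) ^ (2 * D) * (2 * (k + 1 + 6 * D)) ^ (k + 1)) < (m + 1).factorial ∧
      1 / 1056 * (n * (Real.log n / Real.log (max k 2 : ℕ))) ≤ (h * (D + 1) : ℕ) := by
  -- The row length is about the fourth root of n; n ≥ 16⁴ ensures q ≥ 16 and hence log q ≥ 2.
  set q := Nat.sqrt (Nat.sqrt n) with hq
  have hq16 : 16 ≤ q := by
    rw [hq, Nat.le_sqrt', Nat.le_sqrt']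
    omega
  have hq4 : q ^ 4 ≤ n := by
    have h1 := Nat.sqrt_le' (Nat.sqrt n)
    have h2 := Nat.sqrt_le' n
    rw [← hq] at h1
    calc q ^ 4 = (q ^ 2) ^ 2 := by ring
      _ ≤ (Nat.sqrt n) ^ 2 := Nat.pow_le_pow_left h1 2
      _ ≤ n := h2
  have hn4 : n ≤ 16 * q ^ 4 := by
    have h1 : Nat.sqrt n < (q + 1) ^ 2 := Nat.lt_succ_sqrt' _
    have h2 : n < (Nat.sqrt n + 1) ^ 2 := Nat.lt_succ_sqrt' _
    calc n ≤ (Nat.sqrt n + 1) ^ 2 := h2.le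
      _ ≤ ((q + 1) ^ 2) ^ 2 := Nat.pow_le_pow_left h1 2
      _ ≤ ((2 * q) ^ 2) ^ 2 := by gcongr; omega
      _ = 16 * q ^ 4 := by ring
  have hq' : (0 : ℝ) < q := by exact_mod_cast (by omega : 0 < q)
  have hlq := two_le_log_of_sixteen_le hq16
  have hlK := log_max_two_ge k
  set K := Real.log (max k 2 : ℕ) with hK
  have hln : Real.log n ≤ 6 * Real.log q := by
    have h1 : Real.log n ≤ Real.log ((16 * q ^ 4 : ℕ) : ℝ) :=
      Real.log_le_log (by exact_mod_cast (by omega : 0 < n)) (by exact_mod_cast hn4)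
    have h2 : Real.log 16 = 4 * Real.log 2 := by
      rw [show (16 : ℝ) = 2 ^ 4 by norm_num, Real.log_pow]
      norm_num
    have h3 := Real.log_two_lt_d9
    push_cast at h1
    rw [Real.log_mul (by norm_num) (by positivity), Real.log_pow] at h1
    push_cast at h1
    linarith
  rcases lt_or_ge q (20 * (k + 2)) with hkq | hkq
  · left
    -- Here q ≤ 60k ≤ 2⁶k, so k is at least a constant times a fixed power of n and the claimed
    -- ratio is bounded.
    have h1 : Real.log q ≤ (6 + 1) * K := by
      refine le_trans ?_ (log_mul_le (a := 60) (b := 6) (by norm_num) (by norm_num) hk)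
      exact Real.log_le_log hq' (by exact_mod_cast (by omega : q ≤ 60 * k))
    have : Real.log n / K ≤ 42 := by
      rw [div_le_iff₀ (by linarith)]
      linarith
    linarith
  · right
    set D := ⌊q * Real.log q / (88 * K)⌋₊ with hD
    have hD1 : (D : ℝ) ≤ q * Real.log q / (88 * K) := Nat.floor_le (by positivity)
    have hD2 : q * Real.log q / (88 * K) < D + 1 := Nat.lt_floor_add_one _
    have hdiv := Nat.div_add_mod (n - 1 - q) q
    have hmod := Nat.mod_lt (n - 1 - q) (by omega : q > 0)
    have hbig : 4 * q ≤ n := by nlinarith [Nat.pow_le_pow_left hq16 3]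
    refine ⟨q - 1, (n - 1 - q) / q, D, ?_, ?_, ?_, ?_⟩
    · rw [Nat.sub_add_cancel (by omega)]
      nlinarith [Nat.one_le_pow 2 q (by omega)]
    · rw [Nat.sub_add_cancel (by omega), add_mul, Nat.mul_comm]
      omega
    · rw [Nat.sub_add_cancel (by omega)]
      exact count_lt_factorial hq16 hk hkq (by rwa [le_div_iff₀ (by positivity)] at hD1)
    · set h := (n - 1 - q) / q
      -- The rows cover q h ≥ n − 2q ≥ n / 2 keys. Together with log n ≤ 6 log q and the 88 in D
      -- this gives 1056 = 2 · 6 · 88.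
      have h1 : n ≤ 2 * (q * h) := by omega
      have h2 : (n : ℝ) ≤ 2 * (q * h) := by exact_mod_cast h1
      push_cast
      have hln0 : 0 ≤ Real.log n := Real.log_natCast_nonneg n
      calc 1 / 1056 * (n * (Real.log n / K)) ≤ 1 / 1056 * ((2 * (q * h)) * (6 * Real.log q / K)) := by
            gcongr
        _ = h * (q * Real.log q / (88 * K)) := by
            field_simp
            ring
        _ ≤ h * (D + 1) := by gcongr

/-! ### Repeated blocks and the competitive ratio -/

section Assembly

variable {n k j : ℕ} {V : Type} [DecidableEq V]

theorem exists_expensive_block (hn : 65536 ≤ n) (hk : 0 < k) (mode : FingerMode)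
    {alg : OnlineAlgorithm n k} {past : List (Fin n)} {s : State n k V}
    (hs : s.tree.Consistent)
    (hkey : ∀ u v x, s.tree.key u = some x → s.tree.key v = some x → u = v)
    (hcor : alg.CorrectFrom mode past s) (i : Fin j) {s₀ : State n j V} {t : BT (Fin n)}
    (ht : s₀.tree.HasShape t) (hnd : t.leaves.Nodup) (hlen : t.leaves.length = n) :
    ∃ A : List (Fin n), A.Nodup ∧ A.length = n ∧
      1 / 1056 * (n * (Real.log n / Real.log (max k 2 : ℕ))) ≤
        (totalCost (alg.plansFrom past A) : ℝ) ∧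
      ∃ P s₁ t', ServesTo .transient s₀ A P s₁ ∧ totalCost P ≤ 537 * n ∧
        s₁.tree.HasShape t' ∧ A.Perm t'.leaves := by
  rcases exists_parameters hn hk with h | ⟨m, h, D, hm, hh, hcount, hc⟩
  · obtain ⟨A, hA, hAn, hcost, hoff⟩ :=
      exists_block_trivial (by omega) (alg := alg) (past := past) i ht hnd hlen
    refine ⟨A, hA, hAn, ?_, hoff⟩
    have h' : (n : ℝ) ≤ (totalCost (alg.plansFrom past A) : ℝ) := by exact_mod_cast hcost
    refine le_trans ?_ h'
    calc _ = n * (1 / 1056 * (Real.log n / Real.log (max k 2 : ℕ))) := by ring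
      _ ≤ n * 1 := by gcongr
      _ = n := mul_one _
  · obtain ⟨τ, hτ⟩ := exists_perm_forall_lt_cost mode (n := n) hk le_rfl hcount
    obtain ⟨A, hA, hAn, hcost, hoff⟩ :=
      Separating.exists_block hτ hm hh hs hkey hcor i ht hnd hlen
    exact ⟨A, hA, hAn, hc.trans (by exact_mod_cast hcost), hoff⟩

theorem Serves.length_eq {mode : FingerMode} {s : State n k V} {A : List (Fin n)}
    {P : List (Plan k)} (h : Serves mode s A P) : P.length = A.length := by
  induction A generalizing s P with
  | nil =>
    cases P with
    | nil => rfl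
    | cons p P => exact h.elim
  | cons x A ih =>
    cases P with
    | nil => exact h.elim
    | cons p P =>
      obtain ⟨s', -, h'⟩ := h
      rw [List.length_cons, List.length_cons, ih h']

theorem Serves.take {mode : FingerMode} {s : State n k V} {A : List (Fin n)}
    {P : List (Plan k)} (h : Serves mode s A P) (r : ℕ) :
    Serves mode s (A.take r) (P.take r) := by
  rw [← List.take_append_drop r A, ← List.take_append_drop r P] at h
  obtain ⟨s', hs', -⟩ := Serves.of_append (by rw [List.length_take, List.length_take,
    ← List.take_append_drop r A, ← List.take_append_drop r P, h.length_eq]) h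
  exact serves_iff_exists_servesTo.2 ⟨s', hs'⟩

theorem offlineOpt_le {mode : FingerMode} {s : State n k V} {A : List (Fin n)}
    {P : List (Plan k)} (h : Serves mode s A P) : offlineOpt mode s A ≤ totalCost P :=
  iInf₂_le P h

theorem totalCost_take_le (P : List (Plan k)) (r : ℕ) : totalCost (P.take r) ≤ totalCost P := by
  conv_rhs => rw [← List.take_append_drop r P, totalCost_append]
  exact Nat.le_add_right _ _

/-- Concatenation of `q` expensive blocks and a part of a further one. -/
theorem exists_expensive_blocks (hn : 65536 ≤ n) (hk : 0 < k) (mode : FingerMode)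
    {alg : OnlineAlgorithm n k} (i : Fin j) {r : ℕ} (hr : r ≤ n)
    (q : ℕ) {past : List (Fin n)} {s : State n k V}
    (hs : s.tree.Consistent)
    (hkey : ∀ u v x, s.tree.key u = some x → s.tree.key v = some x → u = v)
    (hcor : alg.CorrectFrom mode past s) {s₀ : State n j V} {t : BT (Fin n)}
    (ht : s₀.tree.HasShape t) (hnd : t.leaves.Nodup) (hlen : t.leaves.length = n) :
    ∃ A : List (Fin n), A.length = q * n + r ∧
      q * (1 / 1056 * (n * (Real.log n / Real.log (max k 2 : ℕ)))) ≤
        (totalCost (alg.plansFrom past A) : ℝ) ∧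
      ∃ P, Serves .transient s₀ A P ∧ totalCost P ≤ (q + 1) * (537 * n) := by
  induction q generalizing past s s₀ t with
  | zero =>
    -- The remaining r accesses are a prefix of one more block: they stay cheap offline, and no
    -- online cost is claimed for them.
    obtain ⟨A, -, hAn, -, P, s₁, -, hP, hPcost, -⟩ :=
      exists_expensive_block hn hk mode hs hkey hcor i ht hnd hlen
    refine ⟨A.take r, by simp [hAn, hr], by simp, P.take r,
      (serves_iff_exists_servesTo.2 ⟨s₁, hP⟩).take r, ?_⟩
    have := totalCost_take_le P r
    omega
  | succ q ih =>
    obtain ⟨A, hA, hAn, hcost, P, s₁, t', hP, hPcost, ht', hperm⟩ :=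
      exists_expensive_block hn hk mode hs hkey hcor i ht hnd hlen
    obtain ⟨s', hs', hcor'⟩ := hcor.exists_servesTo A
    obtain ⟨hs'', hk'⟩ := hs'.invariant hs
    obtain ⟨B, hBn, hBcost, Q, hQ, hQcost⟩ := ih hs'' (by rwa [hk']) hcor' ht'
      (hperm.nodup_iff.1 hA) (hperm.length_eq.symm.trans hAn)
    obtain ⟨s₂, hs₂⟩ := serves_iff_exists_servesTo.1 hQ
    refine ⟨A ++ B, by rw [List.length_append, hAn, hBn]; ring, ?_, P ++ Q,
      serves_iff_exists_servesTo.2 ⟨s₂, hP.append hs₂⟩, ?_⟩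
    · rw [alg.plansFrom_append, totalCost_append, Nat.cast_succ, Nat.cast_add]
      linarith
    · rw [totalCost_append]
      linarith

/-- With q ≥ 1 full blocks, the partial block at most doubles the offline bound, whence 1134144 =
1056 · 2 · 537. -/
theorem exists_expensive_of_length (hn : 65536 ≤ n) (hk : 0 < k) (mode : FingerMode)
    {alg : OnlineAlgorithm n k} (i : Fin j) {s : State n k V} (hs : s.tree.Consistent)
    (hkey : ∀ u v x, s.tree.key u = some x → s.tree.key v = some x → u = v)
    (hcor : alg.Correct mode s) {s₀ : State n j V} {t : BT (Fin n)}
    (ht : s₀.tree.HasShape t) (hnd : t.leaves.Nodup) (hlen : t.leaves.length = n)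
    {M : ℕ} (hM : n ≤ M) :
    ∃ A : List (Fin n), A.length = M ∧
      ENNReal.ofReal (1 / 1134144 * (Real.log n / Real.log (max k 2 : ℕ))) ≤
        (alg.cost A : ℝ≥0∞) / offlineOpt .transient s₀ A := by
  set q := M / n
  set X := Real.log n / Real.log (max k 2 : ℕ) with hX
  have hX0 : 0 ≤ X := div_nonneg (Real.log_natCast_nonneg n) (Real.log_natCast_nonneg _)
  have hq : 1 ≤ q := (Nat.one_le_div_iff (by omega)).2 hM
  obtain ⟨A, hA, hcost, P, hP, hPcost⟩ := exists_expensive_blocks hn hk mode i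
    (Nat.mod_lt M (by omega : n > 0)).le q hs hkey hcor ht hnd hlen
  refine ⟨A, hA.trans (Nat.div_add_mod' M n), ?_⟩
  refine le_trans ?_ (ENNReal.div_le_div_left (offlineOpt_le hP) _)
  have hMpos : 0 < q * n + M % n := by
    have := Nat.mul_le_mul hq (by omega : 1 ≤ n)
    omega
  have hpos : 0 < totalCost P := by
    have := length_le_totalCost P
    rw [hP.length_eq, hA] at this
    omega
  rw [ENNReal.le_div_iff_mul_le (.inl (by exact_mod_cast hpos.ne'))
    (.inl (ENNReal.natCast_ne_top _)), ← ENNReal.ofReal_natCast (totalCost P),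
    ← ENNReal.ofReal_mul (by positivity), ← ENNReal.ofReal_natCast (alg.cost A)]
  refine ENNReal.ofReal_le_ofReal (le_trans ?_ hcost)
  have hP' : (totalCost P : ℝ) ≤ 2 * q * (537 * n) := by
    have : totalCost P ≤ 2 * q * (537 * n) :=
      hPcost.trans (Nat.mul_le_mul_right _ (by omega))
    exact_mod_cast this
  calc _ ≤ 1 / 1134144 * X * (2 * q * (537 * n)) := by gcongr
    _ = q * (1 / 1056 * (n * X)) := by ring

end Assembly

end TournamentHeap

theorem mainTheorem4 :
    ∃ c C : ℝ, 0 < c ∧ 0 < C ∧ ∃ n₀ : ℕ, ∀ n : ℕ, n₀ ≤ n → ∀ k : ℕ, 1 ≤ k →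
      ∀ (V : Type) [Finite V] [DecidableEq V] (T : TournamentHeap.PTree n V), T.IsTournament →
      ∀ (mode : TournamentHeap.FingerMode) (pos : Fin k → V)
        (alg : TournamentHeap.OnlineAlgorithm n k),
        alg.Correct mode { tree := T, finger := pos, temp := none } →
        (∃ A : List (Fin n), A.Nodup ∧ A.length = n ∧
          c * (n * (Real.log n / Real.log (max k 2 : ℕ))) ≤ (alg.cost A : ℝ) ∧
          TournamentHeap.offlineOpt .transient (T.atRoot 1) A ≤ ENNReal.ofReal (C * n)) ∧
        ∀ j : ℕ, 1 ≤ j →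
          ENNReal.ofReal (c * (Real.log n / Real.log (max k 2 : ℕ))) ≤
            alg.competitiveRatio .transient j T := by
  refine ⟨1 / 1134144, 537, by norm_num, by norm_num, 65536, fun n hn k hk V _ _ T hT mode pos alg
    hcor => ?_⟩
  obtain ⟨t, ht, hnd, hlen⟩ := hT.exists_hasShape
  constructor
  · obtain ⟨A, hA, hAn, hcost, P, s₁, -, hP, hPcost, -⟩ :=
      TournamentHeap.exists_expensive_block hn hk mode
        (s := { tree := T, finger := pos, temp := none }) hT.consistent hT.key_inj hcor
        (0 : Fin 1) (s₀ := T.atRoot 1) ht hnd hlen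
    refine ⟨A, hA, hAn, le_trans ?_ hcost, ?_⟩
    · have : 0 ≤ Real.log n / Real.log (max k 2 : ℕ) :=
        div_nonneg (Real.log_natCast_nonneg n) (Real.log_natCast_nonneg _)
      gcongr
      norm_num
    · refine (TournamentHeap.offlineOpt_le
        (TournamentHeap.serves_iff_exists_servesTo.2 ⟨s₁, hP⟩)).trans ?_
      rw [← ENNReal.ofReal_natCast]
      exact ENNReal.ofReal_le_ofReal (by exact_mod_cast hPcost)
  · intro j hj
    refine Filter.le_liminf_of_le (by isBoundedDefault) ?_
    -- From length n on, every length admits a sequence with the required quotient, so the bound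
    -- passes to the lower limit.
    filter_upwards [Filter.eventually_ge_atTop n] with M hM
    obtain ⟨A, hA, hratio⟩ := TournamentHeap.exists_expensive_of_length hn hk mode
      (⟨0, hj⟩ : Fin j) (s := { tree := T, finger := pos, temp := none }) hT.consistent hT.key_inj
      hcor (s₀ := T.atRoot j) ht hnd hlen hM
    exact le_iSup₂_of_le A hA hratio
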